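/- Let $I=[-a,b]$ with $0<a,b<\infty$. Let $r:I\to\mathbb R^3$ be a simple $C^2$ curve parametrized by arc length $s$, with tangent $r'$, normal $N$, binormal $B=r'\times N$, curvature $k$ and torsion $\tau$ satisfying the Frenet equations, and let $\alpha:I\to\mathbb R$ be differentiable with $\alpha(0)=0$; assume $\|\tau\|_\infty,\|\alpha'\|_\infty<\infty$ (on the compact interval $I$ the curvature $k=|r''|$ is automatically bounded). Let $h:I\to(0,\infty)$ be continuous on $I$ and $C^1$ on $I\setminus\{0\}$, with $\|h'/h\|_\infty<\infty$, with $s=0$ as its only point of global maximum, and with $$h(s)=M-s^2+O(|s|^3)\quad (s\to0),\qquad M>0 .$$ Let $S\subset\mathbb R^2$ be nonempty, open, bounded and simply connected, let $\lambda_0$ be the lowest eigenvalue of the Dirichlet Laplacian $-\Delta$ in $S$ and let $u_0\in H_0^1(S)$ be the corresponding positive eigenfunction with $\int_S u_0^2\,dy=1$. With $Ry=(y_2,-y_1)$ put $$C_1=\int_S\langle\nabla u_0,Ry\rangle^2dy,\quad C_2=\int_S\langle\nabla u_0,y\rangle^2dy,\quad C_3=\int_S\langle\nabla u_0,Ry\rangle\langle\nabla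 u_0,y\rangle dy,\quad F=\int_S y\,u_0(y)^2dy\in\mathbb R^2,$$ $$\vartheta=C_1(\tau+\alpha')^2+(C_2-1)\Big(\frac{h'}{h}\Big)^2-2C_3(\tau+\alpha')\frac{h'}{h},\qquad \zeta_\varepsilon=1-\varepsilon\,k\,h\,\langle(\cos\alpha,-\sin\alpha),F\rangle .$$ Let $c\in\mathbb R$ and, for $\varepsilon>0$, $$W_\varepsilon(s)=\vartheta(s)+c+\zeta_\varepsilon(s)\Big(\frac{\lambda_0}{\varepsilon^2h(s)^2}-\frac{\lambda_0}{\varepsilon^2M^2}\Big),\qquad T_{\varepsilon,c}w=-w''+W_\varepsilon w,\quad \operatorname{dom}T_{\varepsilon,c}=H^2(I)\cap H_0^1(I)$$ in $L^2(I)$. Let $I_\varepsilon=(-a\varepsilon^{-1/2},b\varepsilon^{-1/2})$, let $J_\varepsilon:L^2(I)\to L^2(I_\varepsilon)$ be the unitary operator $(J_\varepsilon\psi)(s)=\varepsilon^{1/4}\psi(\varepsilon^{1/2}s)$, and let $\hat T_{\varepsilon,c}=\varepsilon J_\varepsilon T_{\varepsilon,c}J_\varepsilon^{-1}$ in $L^2(I_\varepsilon)$.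 Let $T$ be the harmonic oscillator $$Tu=-u''+\frac{2\lambda_0}{M^3}\,s^2u,\qquad \operatorname{dom}T=\{u\in H^2(\mathbb R): s^2u\in L^2(\mathbb R)\}$$ in $L^2(\mathbb R)$. Then $T$ has a bounded everywhere defined inverse, so does $\hat T_{\varepsilon,c}$ for all sufficiently small $\varepsilon>0$, and $$\big\|\hat T_{\varepsilon,c}^{-1}\oplus 0-T^{-1}\big\|\to0\qquad(\varepsilon\to0^+)$$ in the operator norm of $L^2(\mathbb R)$, where $0$ is the null operator on $L^2(\mathbb R\setminus I_\varepsilon)$ and $L^2(\mathbb R)=L^2(I_\varepsilon)\oplus L^2(\mathbb R\setminus I_\varepsilon)$. -/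

import Mathlib

open MeasureTheory Filter Topology Set
open scoped ENNReal ContDiff

noncomputable section

namespace ThinTube

/-! ### Test functions and the cross-section problem -/

/-- `φ ∈ C_c^∞(Ω)`: smooth, with compact support contained in `Ω`. -/
def IsTest {E F : Type*} [NormedAddCommGroup E] [NormedSpace ℝ E] [NormedAddCommGroup F]
    [NormedSpace ℝ F] (Ω : Set E) (φ : E → F) : Prop :=
  ContDiff ℝ ∞ φ ∧ HasCompactSupport φ ∧ tsupport φ ⊆ Ω

/-- The plane `ℝ²` with its Euclidean structure. -/
abbrev Plane : Type := EuclideanSpace ℝ (Fin 2)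

/-- Three-dimensional Euclidean space. -/
abbrev Space : Type := EuclideanSpace ℝ (Fin 3)

/-- `u ∈ H_0^1(S)` with (weak) gradient `G`: the pair `(u, G)` is the limit in `L²(S)` of pairs
`(φ_n, ∇φ_n)` with `φ_n ∈ C_c^∞(S)`. -/
structure IsH01Plane (S : Set Plane) (u : Plane → ℝ) (G : Plane → Plane) : Prop where
  memLp : MemLp u 2 (volume.restrict S)
  memLp_grad : MemLp G 2 (volume.restrict S)
  approx : ∃ φ : ℕ → Plane → ℝ, (∀ n, IsTest S (φ n)) ∧
    Tendsto (fun n => eLpNorm (fun y => φ n y - u y) 2 (volume.restrict S)) atTop (𝓝 0) ∧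
    Tendsto (fun n => eLpNorm (fun y => gradient (φ n) y - G y) 2 (volume.restrict S))
      atTop (𝓝 0)

/-- `u ∈ H_0^1(S)`, `u ≠ 0`, with gradient `G`, solves `-Δu = lam u` weakly in `S`. -/
structure IsDirichletEigenpair (S : Set Plane) (lam : ℝ) (u : Plane → ℝ) (G : Plane → Plane) :
    Prop where
  h01 : IsH01Plane S u G
  ne_zero : ¬ (u =ᵐ[volume.restrict S] fun _ => 0)
  weak : ∀ φ : Plane → ℝ, IsTest S φ →
    ∫ y in S, inner ℝ (G y) (gradient φ y) = lam * ∫ y in S, u y * φ y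

/-- `lam` is an eigenvalue of the Dirichlet operator `-Δ` in `S`. -/
def IsDirichletEigenvalue (S : Set Plane) (lam : ℝ) : Prop :=
  ∃ u G, IsDirichletEigenpair S lam u G

/-- `lam0` is the lowest Dirichlet eigenvalue of `-Δ` in `S`, and `u0` (with gradient `G0`) is the
positive normalized eigenfunction. -/
structure IsDirichletGroundState (S : Set Plane) (lam0 : ℝ) (u0 : Plane → ℝ)
    (G0 : Plane → Plane) : Prop where
  lowest : IsLeast {lam | IsDirichletEigenvalue S lam} lam0
  eigen : IsDirichletEigenpair S lam0 u0 G0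
  pos : ∀ᵐ y ∂(volume.restrict S), 0 < u0 y
  normalized : ∫ y in S, u0 y ^ 2 = 1

/-- `R y = (y₂, -y₁)`. -/
def rot (y : Plane) : Plane := !₂[y 1, -y 0]

/-- `C₁(S) = ∫_S ⟨∇u₀, R y⟩² dy`. -/
def C1 (S : Set Plane) (G0 : Plane → Plane) : ℝ := ∫ y in S, (inner ℝ (G0 y) (rot y)) ^ 2

/-- `C₂(S) = ∫_S ⟨∇u₀, y⟩² dy`. -/
def C2 (S : Set Plane) (G0 : Plane → Plane) : ℝ := ∫ y in S, (inner ℝ (G0 y) y) ^ 2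

/-- `C₃(S) = ∫_S ⟨∇u₀, R y⟩ ⟨∇u₀, y⟩ dy`. -/
def C3 (S : Set Plane) (G0 : Plane → Plane) : ℝ :=
  ∫ y in S, inner ℝ (G0 y) (rot y) * inner ℝ (G0 y) y

/-- `F(S) = ∫_S y u₀(y)² dy`. -/
def F (S : Set Plane) (u0 : Plane → ℝ) : Plane :=
  !₂[∫ y in S, y 0 * u0 y ^ 2, ∫ y in S, y 1 * u0 y ^ 2]

/-! ### The curve and the deformation function -/

/-- Cross product in `ℝ³`. -/
def cross (v w : Space) : Space := WithLp.toLp 2 (crossProduct (WithLp.ofLp v) (WithLp.ofLp w))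

/-- `r : I → ℝ³` is a simple `C²` curve parametrized by arc length, with curvature `k`, torsion
`τ`, normal `N` and binormal `B` (the tangent is `T = r'`), and the Frenet equations hold.
Where `k > 0`, the field `normal` says `N = T' / k`. -/
structure IsFrenetCurve (I : Set ℝ) (r N B : ℝ → Space) (k τ : ℝ → ℝ) : Prop where
  contDiffOn : ContDiffOn ℝ 2 r I
  injOn : InjOn r I
  unit_speed : ∀ s ∈ I, ‖derivWithin r I s‖ = 1
  curvature : ∀ s ∈ I, k s = ‖derivWithin (derivWithin r I) I s‖
  normal : ∀ s ∈ I, derivWithin (derivWithin r I) I s = k s • N s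
  norm_normal : ∀ s ∈ I, ‖N s‖ = 1
  orthogonal : ∀ s ∈ I, inner ℝ (derivWithin r I s) (N s) = 0
  binormal : ∀ s ∈ I, B s = cross (derivWithin r I s) (N s)
  frenet_normal : ∀ s ∈ I, HasDerivWithinAt N (-(k s) • derivWithin r I s + τ s • B s) I s
  frenet_binormal : ∀ s ∈ I, HasDerivWithinAt B (-(τ s) • N s) I s

/-- The conditions on the deformation function `h > 0` on `I`: it is continuous, `C¹` away from
`0`, `h'/h` is bounded, `0` is the only point of global maximum, and
`h(s) = M - s² + O(|s|³)` as `s → 0`, with `M > 0`. -/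
structure IsDeformation (I : Set ℝ) (h : ℝ → ℝ) (M : ℝ) : Prop where
  M_pos : 0 < M
  pos : ∀ s ∈ I, 0 < h s
  continuousOn : ContinuousOn h I
  contDiffOn : ContDiffOn ℝ 1 h (I \ {0})
  bounded : ∃ C : ℝ, ∀ᵐ s ∂(volume.restrict I), |derivWithin h I s / h s| ≤ C
  unique_max : ∀ s ∈ I, s ≠ 0 → h s < h 0
  expansion : (fun s => h s - (M - s ^ 2)) =O[𝓝 0] fun s => |s| ^ 3

/-- `ϑ(s) = C₁(S)(τ+α')² + (C₂(S) - 1)(h'/h)² - 2 C₃(S)(τ+α') h'/h`. -/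
def vartheta (I : Set ℝ) (S : Set Plane) (G0 : Plane → Plane) (τ α h : ℝ → ℝ) (s : ℝ) : ℝ :=
  C1 S G0 * (τ s + derivWithin α I s) ^ 2 + (C2 S G0 - 1) * (derivWithin h I s / h s) ^ 2
    - 2 * C3 S G0 * (τ s + derivWithin α I s) * (derivWithin h I s / h s)

/-- `ζ_ε(s) = 1 - ε k(s) h(s) ⟨z_α(s), F(S)⟩` with `z_α = (cos α, -sin α)`. -/
def zeta (S : Set Plane) (u0 : Plane → ℝ) (k α h : ℝ → ℝ) (ε s : ℝ) : ℝ :=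
  1 - ε * k s * h s * inner ℝ (!₂[Real.cos (α s), -Real.sin (α s)] : Plane) (F S u0)

/-- `W_ε(s) = ϑ(s) + c + ζ_ε(s) (λ₀ / (ε² h(s)²) - λ₀ / (ε² M²))`. -/
def effPotential (I : Set ℝ) (S : Set Plane) (lam0 : ℝ) (u0 : Plane → ℝ) (G0 : Plane → Plane)
    (k τ α h : ℝ → ℝ) (M c ε s : ℝ) : ℝ :=
  vartheta I S G0 τ α h s + c
    + zeta S u0 k α h ε s * (lam0 / (ε ^ 2 * h s ^ 2) - lam0 / (ε ^ 2 * M ^ 2))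

/-! ### One-dimensional Schrödinger operators with Dirichlet condition -/

/-- The complex Hilbert space `L²(Ω)`, `Ω ⊆ ℝ`. -/
abbrev L2 (Ω : Set ℝ) : Type := Lp ℂ 2 (volume.restrict Ω)

/-- `g ∈ L²(Ω)` is the weak derivative of `u ∈ L²(Ω)` in `Ω`. -/
def IsWeakDeriv (Ω : Set ℝ) (u g : L2 Ω) : Prop :=
  ∀ φ : ℝ → ℂ, IsTest Ω φ → ∫ s in Ω, u s * deriv φ s = -∫ s in Ω, g s * φ s

/-- `u ∈ H²(Ω)`, with weak derivatives `u'` and `u''`. -/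
def IsH2 (Ω : Set ℝ) (u u' u'' : L2 Ω) : Prop :=
  IsWeakDeriv Ω u u' ∧ IsWeakDeriv Ω u' u''

/-- `u ∈ H_0^1(Ω)`, the closure of `C_c^∞(Ω)` in `H¹(Ω)`; `u'` is the weak derivative of `u`. -/
def IsH01 (Ω : Set ℝ) (u u' : L2 Ω) : Prop :=
  IsWeakDeriv Ω u u' ∧ ∃ φ : ℕ → ℝ → ℂ, (∀ n, IsTest Ω (φ n)) ∧
    Tendsto (fun n => eLpNorm (fun s => φ n s - u s) 2 (volume.restrict Ω)) atTop (𝓝 0) ∧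
    Tendsto (fun n => eLpNorm (fun s => deriv (φ n) s - u' s) 2 (volume.restrict Ω)) atTop (𝓝 0)

theorem IsTest.integrable_mul {Ω : Set ℝ} {φ : ℝ → ℂ} (hc : Continuous φ)
    (hs : HasCompactSupport φ) (u : L2 Ω) :
    Integrable (fun s => u s * φ s) (volume.restrict Ω) :=
  (Lp.memLp u).integrable_mul (p := 2) (q := 2) (hc.memLp_of_hasCompactSupport hs)

theorem IsTest.int₁ {Ω : Set ℝ} {φ : ℝ → ℂ} (hφ : IsTest Ω φ) (u : L2 Ω) :
    Integrable (fun s => u s * φ s) (volume.restrict Ω) :=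
  IsTest.integrable_mul hφ.1.continuous hφ.2.1 u

theorem IsTest.int₂ {Ω : Set ℝ} {φ : ℝ → ℂ} (hφ : IsTest Ω φ) (u : L2 Ω) :
    Integrable (fun s => u s * deriv φ s) (volume.restrict Ω) :=
  IsTest.integrable_mul (hφ.1.continuous_deriv (by simp)) hφ.2.1.deriv u

theorem IsTest.zero (Ω : Set ℝ) : IsTest Ω (fun _ : ℝ => (0 : ℂ)) :=
  ⟨contDiff_const, HasCompactSupport.zero, by simp [tsupport, Function.support]⟩

theorem IsTest.add {Ω : Set ℝ} {φ ψ : ℝ → ℂ} (h₁ : IsTest Ω φ) (h₂ : IsTest Ω ψ) :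
    IsTest Ω (fun s => φ s + ψ s) :=
  ⟨h₁.1.add h₂.1, h₁.2.1.add h₂.2.1,
    (tsupport_add φ ψ).trans (union_subset h₁.2.2 h₂.2.2)⟩

theorem IsTest.smul {Ω : Set ℝ} {φ : ℝ → ℂ} (a : ℂ) (h₁ : IsTest Ω φ) :
    IsTest Ω (fun s => a * φ s) :=
  ⟨contDiff_const.mul h₁.1, h₁.2.1.mul_left,
    (tsupport_mul_subset_right (f := fun _ => a) (g := φ)).trans h₁.2.2⟩

theorem IsWeakDeriv.zero (Ω : Set ℝ) : IsWeakDeriv Ω 0 0 := by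
  intro φ _
  have h0 : ((0 : L2 Ω) : ℝ → ℂ) =ᵐ[volume.restrict Ω] 0 := Lp.coeFn_zero _ _ _
  have e : ∀ ψ : ℝ → ℂ, ∫ s in Ω, (0 : L2 Ω) s * ψ s = 0 := fun ψ => by
    rw [integral_congr_ae (g := fun _ => (0 : ℂ))
      (by filter_upwards [h0] with s hs; rw [hs, Pi.zero_apply, zero_mul]), integral_zero]
  rw [e, e, neg_zero]

theorem IsWeakDeriv.add {Ω : Set ℝ} {u v u' v' : L2 Ω} (hu : IsWeakDeriv Ω u u')
    (hv : IsWeakDeriv Ω v v') : IsWeakDeriv Ω (u + v) (u' + v') := by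
  intro φ hφ
  have e1 : ∫ s in Ω, (u + v : L2 Ω) s * deriv φ s
      = ∫ s in Ω, (u s * deriv φ s + v s * deriv φ s) := integral_congr_ae
    (by filter_upwards [Lp.coeFn_add u v] with s hs; rw [hs, Pi.add_apply, add_mul])
  have e2 : ∫ s in Ω, (u' + v' : L2 Ω) s * φ s
      = ∫ s in Ω, (u' s * φ s + v' s * φ s) := integral_congr_ae
    (by filter_upwards [Lp.coeFn_add u' v'] with s hs; rw [hs, Pi.add_apply, add_mul])
  rw [e1, e2, integral_add (hφ.int₂ u) (hφ.int₂ v), integral_add (hφ.int₁ u') (hφ.int₁ v'),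
    hu φ hφ, hv φ hφ]
  ring

theorem IsWeakDeriv.smul {Ω : Set ℝ} {u u' : L2 Ω} (a : ℂ) (hu : IsWeakDeriv Ω u u') :
    IsWeakDeriv Ω (a • u) (a • u') := by
  intro φ hφ
  have e1 : ∫ s in Ω, (a • u : L2 Ω) s * deriv φ s = ∫ s in Ω, a * (u s * deriv φ s) :=
    integral_congr_ae (by
      filter_upwards [Lp.coeFn_smul a u] with s hs
      rw [hs, Pi.smul_apply, smul_eq_mul, mul_assoc])
  have e2 : ∫ s in Ω, (a • u' : L2 Ω) s * φ s = ∫ s in Ω, a * (u' s * φ s) :=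
    integral_congr_ae (by
      filter_upwards [Lp.coeFn_smul a u'] with s hs
      rw [hs, Pi.smul_apply, smul_eq_mul, mul_assoc])
  rw [e1, e2, integral_const_mul, integral_const_mul, hu φ hφ]
  ring

theorem IsWeakDeriv.eq_zero {Ω : Set ℝ} (hΩ : IsOpen Ω) {g : L2 Ω} (hg : IsWeakDeriv Ω 0 g) :
    g = 0 := by
  have h0 : ((0 : L2 Ω) : ℝ → ℂ) =ᵐ[volume.restrict Ω] 0 := Lp.coeFn_zero _ _ _
  have hloc : LocallyIntegrableOn g Ω volume := by
    rw [locallyIntegrableOn_iff hΩ.isLocallyClosed]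
    intro K hK hKc
    have h1 : MemLp g 2 (volume.restrict K) :=
      (Lp.memLp g).mono_measure (Measure.restrict_mono hK le_rfl)
    have : IsFiniteMeasure (volume.restrict K) :=
      ⟨by simpa using hKc.measure_lt_top⟩
    exact h1.integrable (by norm_num)
  have key := hΩ.ae_eq_zero_of_integral_contDiff_smul_eq_zero hloc (fun φ hφ hc hs => ?_)
  · refine Lp.ext ?_
    have := (ae_restrict_iff' hΩ.measurableSet).2 key
    filter_upwards [this, h0] with s h1 h2
    rw [h1, h2, Pi.zero_apply]
  · have ht : IsTest Ω (fun s => (φ s : ℂ)) :=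
      ⟨Complex.ofRealCLM.contDiff.comp hφ, hc.comp_left (g := fun x : ℝ => (x : ℂ)) (by simp),
        (tsupport_comp_subset (g := fun x : ℝ => (x : ℂ)) (by simp) φ).trans hs⟩
    have h1 := hg _ ht
    rw [integral_congr_ae (g := fun _ => (0 : ℂ))
      (by filter_upwards [h0] with s hs; rw [hs, Pi.zero_apply, zero_mul])] at h1
    simp only [integral_zero] at h1
    have h2 : ∫ s in Ω, φ s • g s = 0 := by
      have : ∫ s in Ω, φ s • g s = ∫ s in Ω, g s * (φ s : ℂ) := by
        congr 1; ext s; simp [mul_comm]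
      rw [this]; exact neg_eq_zero.1 h1.symm
    rw [← h2]
    symm
    apply setIntegral_eq_integral_of_forall_compl_eq_zero
    intro s hsΩ
    rw [image_eq_zero_of_notMem_tsupport (fun hmem => hsΩ (hs hmem)), zero_smul]

theorem IsH01.zero (Ω : Set ℝ) : IsH01 Ω 0 0 := by
  refine ⟨IsWeakDeriv.zero Ω, fun _ _ => 0, fun _ => IsTest.zero Ω, ?_, ?_⟩
  all_goals
    refine tendsto_const_nhds.congr fun n => ?_
    symm
    rw [eLpNorm_congr_ae (g := fun _ => (0 : ℂ))]
    · simp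
    · filter_upwards [Lp.coeFn_zero ℂ 2 (volume.restrict Ω)] with s hs
      rw [hs]
      simp

theorem tendsto_add_aux {Ω : Set ℝ} {f g : ℕ → ℝ → ℂ} {u v : L2 Ω} (hf : ∀ n, Continuous (f n))
    (hg : ∀ n, Continuous (g n))
    (h₁ : Tendsto (fun n => eLpNorm (fun s => f n s - u s) 2 (volume.restrict Ω)) atTop (𝓝 0))
    (h₂ : Tendsto (fun n => eLpNorm (fun s => g n s - v s) 2 (volume.restrict Ω)) atTop (𝓝 0)) :
    Tendsto (fun n => eLpNorm (fun s => f n s + g n s - (u + v : L2 Ω) s) 2 (volume.restrict Ω))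
      atTop (𝓝 0) := by
  have h3 := h₁.add h₂
  rw [add_zero] at h3
  refine tendsto_of_tendsto_of_tendsto_of_le_of_le tendsto_const_nhds h3 (fun _ => zero_le) ?_
  intro n
  dsimp only
  rw [eLpNorm_congr_ae (g := (fun s => f n s - u s) + fun s => g n s - v s)
    (by filter_upwards [Lp.coeFn_add u v] with s hs; rw [hs]; simp only [Pi.add_apply]; ring)]
  exact eLpNorm_add_le ((hf n).aestronglyMeasurable.sub (Lp.aestronglyMeasurable u))
    ((hg n).aestronglyMeasurable.sub (Lp.aestronglyMeasurable v)) (by norm_num)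

theorem tendsto_smul_aux {Ω : Set ℝ} {f : ℕ → ℝ → ℂ} {u : L2 Ω} (a : ℂ)
    (h₁ : Tendsto (fun n => eLpNorm (fun s => f n s - u s) 2 (volume.restrict Ω)) atTop (𝓝 0)) :
    Tendsto (fun n => eLpNorm (fun s => a * f n s - (a • u : L2 Ω) s) 2 (volume.restrict Ω))
      atTop (𝓝 0) := by
  have h3 := ENNReal.Tendsto.const_mul (a := ‖a‖ₑ) h₁ (.inr (by simp))
  rw [mul_zero] at h3
  refine h3.congr fun n => ?_
  rw [← eLpNorm_const_smul]
  refine eLpNorm_congr_ae ?_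
  filter_upwards [Lp.coeFn_smul a u] with s hs
  simp [hs, mul_sub]

theorem IsH01.add {Ω : Set ℝ} {u v u' v' : L2 Ω} (hu : IsH01 Ω u u') (hv : IsH01 Ω v v') :
    IsH01 Ω (u + v) (u' + v') := by
  obtain ⟨hw, φ, hφ, h1, h2⟩ := hu
  obtain ⟨hw', ψ, hψ, h1', h2'⟩ := hv
  refine ⟨hw.add hw', fun n s => φ n s + ψ n s, fun n => (hφ n).add (hψ n),
    tendsto_add_aux (fun n => (hφ n).1.continuous) (fun n => (hψ n).1.continuous) h1 h1', ?_⟩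
  have := tendsto_add_aux (fun n => (hφ n).1.continuous_deriv (by simp))
    (fun n => (hψ n).1.continuous_deriv (by simp)) h2 h2'
  refine this.congr fun n => ?_
  congr 1
  ext s
  rw [deriv_fun_add ((hφ n).1.differentiable (by simp) s)
    ((hψ n).1.differentiable (by simp) s)]

theorem IsH01.smul {Ω : Set ℝ} {u u' : L2 Ω} (a : ℂ) (hu : IsH01 Ω u u') :
    IsH01 Ω (a • u) (a • u') := by
  obtain ⟨hw, φ, hφ, h1, h2⟩ := hu
  refine ⟨hw.smul a, fun n s => a * φ n s, fun n => (hφ n).smul a, tendsto_smul_aux a h1, ?_⟩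
  refine (tendsto_smul_aux a h2).congr fun n => ?_
  congr 1
  ext s
  rw [deriv_const_mul a ((hφ n).1.differentiable (by simp) s)]

/-- The graph of `u ↦ -u'' + V u` on the domain
`{u ∈ H²(Ω) ∩ H_0^1(Ω) : V u ∈ L²(Ω)}`. -/
def schrodingerGraph (Ω : Set ℝ) (V : ℝ → ℝ) : Submodule ℂ (L2 Ω × L2 Ω) where
  carrier := {p | ∃ u' u'' Vu : L2 Ω, IsH2 Ω p.1 u' u'' ∧ IsH01 Ω p.1 u' ∧
    (Vu =ᵐ[volume.restrict Ω] fun s => (V s : ℂ) * p.1 s) ∧ p.2 = -u'' + Vu}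
  zero_mem' := by
    refine ⟨0, 0, 0, ⟨IsWeakDeriv.zero Ω, IsWeakDeriv.zero Ω⟩, IsH01.zero Ω, ?_, by simp⟩
    filter_upwards [Lp.coeFn_zero ℂ 2 (volume.restrict Ω)] with s hs
    rw [hs, Prod.fst_zero, hs, Pi.zero_apply, mul_zero]
  add_mem' := by
    rintro p q ⟨u', u'', Vu, h2, h01, hV, hp⟩ ⟨v', v'', Vv, k2, k01, kV, kp⟩
    refine ⟨u' + v', u'' + v'', Vu + Vv, ⟨h2.1.add k2.1, h2.2.add k2.2⟩, h01.add k01, ?_, ?_⟩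
    · filter_upwards [hV, kV, Lp.coeFn_add Vu Vv, Lp.coeFn_add p.1 q.1] with s a1 a2 a3 a4
      rw [Prod.fst_add, a3, a4, Pi.add_apply, Pi.add_apply, a1, a2, mul_add]
    · rw [Prod.snd_add, hp, kp]; abel
  smul_mem' := by
    rintro a p ⟨u', u'', Vu, h2, h01, hV, hp⟩
    refine ⟨a • u', a • u'', a • Vu, ⟨h2.1.smul a, h2.2.smul a⟩, h01.smul a, ?_, ?_⟩
    · filter_upwards [hV, Lp.coeFn_smul a Vu, Lp.coeFn_smul a p.1] with s a1 a2 a3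
      rw [Prod.smul_fst, a2, a3, Pi.smul_apply, Pi.smul_apply, a1, smul_eq_mul, smul_eq_mul]
      ring
    · rw [Prod.smul_snd, hp, smul_add, smul_neg]

/-- The operator `u ↦ -u'' + V u` in `L²(Ω)` with domain
`{u ∈ H²(Ω) ∩ H_0^1(Ω) : V u ∈ L²(Ω)}`, for `Ω` open. -/
def schrodinger (Ω : Set ℝ) (V : ℝ → ℝ) : L2 Ω →ₗ.[ℂ] L2 Ω :=
  (schrodingerGraph Ω V).toLinearPMap

theorem schrodinger_graph {Ω : Set ℝ} (hΩ : IsOpen Ω) (V : ℝ → ℝ) :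
    (schrodinger Ω V).graph = schrodingerGraph Ω V := by
  refine Submodule.toLinearPMap_graph_eq _ ?_
  rintro ⟨u, f⟩ ⟨u', u'', Vu, h2, -, hV, hp⟩ hu
  simp only at hu h2 hV hp
  subst hu
  have e1 : u' = 0 := h2.1.eq_zero hΩ
  have h3 := h2.2
  rw [e1] at h3
  have e2 : u'' = 0 := h3.eq_zero hΩ
  have e3 : Vu = 0 := by
    refine Lp.ext ?_
    filter_upwards [hV, Lp.coeFn_zero ℂ 2 (volume.restrict Ω)] with s a1 a2
    rw [a1, a2, Pi.zero_apply, mul_zero]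
  simp [hp, e2, e3]

/-- The bounded everywhere defined operator `B` is the inverse of the unbounded operator `A`. -/
def IsBoundedInverse {H : Type*} [NormedAddCommGroup H] [NormedSpace ℂ H]
    (A : H →ₗ.[ℂ] H) (B : H →L[ℂ] H) : Prop :=
  (∀ f : H, ∃ hf : B f ∈ A.domain, A ⟨B f, hf⟩ = f) ∧ ∀ u : A.domain, B (A u) = u

/-! ### Dilations -/

theorem map_mul_restrict {A B : Set ℝ} {c : ℝ} (hc : 0 < c) (hB : (fun s => c * s) ⁻¹' A = B) :
    Measure.map (fun s => c * s) (volume.restrict B) =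
      ENNReal.ofReal c⁻¹ • volume.restrict A := by
  have he : MeasurableEmbedding (fun s : ℝ => c * s) :=
    (Homeomorph.mulLeft₀ c hc.ne').measurableEmbedding
  rw [← hB, ← he.restrict_map, Real.map_volume_mul_left hc.ne', abs_of_pos (inv_pos.2 hc),
    Measure.restrict_smul]

theorem eLpNorm_dilate {A B : Set ℝ} {c : ℝ} (hc : 0 < c) (hB : (fun s => c * s) ⁻¹' A = B)
    (ψ : L2 A) :
    MemLp (fun s => ((√c : ℝ) : ℂ) * ψ (c * s)) 2 (volume.restrict B) ∧
      eLpNorm (fun s => ((√c : ℝ) : ℂ) * ψ (c * s)) 2 (volume.restrict B) =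
        eLpNorm ψ 2 (volume.restrict A) := by
  have he : MeasurableEmbedding (fun s : ℝ => c * s) :=
    (Homeomorph.mulLeft₀ c hc.ne').measurableEmbedding
  have hm := map_mul_restrict hc hB
  have h1 : MemLp ψ 2 (Measure.map (fun s => c * s) (volume.restrict B)) := by
    rw [hm]; exact (Lp.memLp ψ).smul_measure (by simp)
  have h2 : MemLp (fun s => ψ (c * s)) 2 (volume.restrict B) :=
    h1.comp_of_map he.measurable.aemeasurable
  refine ⟨h2.const_mul _, ?_⟩
  have h3 : eLpNorm (fun s => ψ (c * s)) 2 (volume.restrict B) =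
      eLpNorm ψ 2 (ENNReal.ofReal c⁻¹ • volume.restrict A) := by
    rw [← hm, eLpNorm_map_measure h1.1 he.measurable.aemeasurable]
    rfl
  have h4 : (fun s => ((√c : ℝ) : ℂ) * ψ (c * s)) = ((√c : ℝ) : ℂ) • fun s => ψ (c * s) := by
    ext s; simp
  rw [h4, eLpNorm_const_smul, h3, eLpNorm_smul_measure_of_ne_top (by simp), smul_eq_mul,
    ← mul_assoc]
  have h5 : ‖((√c : ℝ) : ℂ)‖ₑ * ENNReal.ofReal c⁻¹ ^ (1 / (2 : ℝ≥0∞)).toReal = 1 := by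
    rw [← ofReal_norm, Complex.norm_real, Real.norm_of_nonneg (Real.sqrt_nonneg _),
      ENNReal.ofReal_rpow_of_nonneg (by positivity) (by positivity),
      ← ENNReal.ofReal_mul (Real.sqrt_nonneg _)]
    have : √c * c⁻¹ ^ (1 / (2 : ℝ≥0∞)).toReal = 1 := by
      have : (1 / (2 : ℝ≥0∞)).toReal = 1 / 2 := by simp
      rw [this, ← Real.sqrt_eq_rpow, ← Real.sqrt_mul hc.le, mul_inv_cancel₀ hc.ne', Real.sqrt_one]
    rw [this, ENNReal.ofReal_one]
  rw [h5, one_mul]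

/-- The dilation `L²(A) → L²(c⁻¹A)`, `ψ ↦ (s ↦ c^{1/2} ψ(c s))`. -/
def dilate {A B : Set ℝ} {c : ℝ} (hc : 0 < c) (hB : (fun s => c * s) ⁻¹' A = B) :
    L2 A →ₗᵢ[ℂ] L2 B where
  toFun ψ := (eLpNorm_dilate hc hB ψ).1.toLp _
  map_add' ψ₁ ψ₂ := by
    refine Lp.ext ?_
    have hq := (Homeomorph.mulLeft₀ c hc.ne').measurableEmbedding.measurable
    have e : ∀ᵐ s ∂(volume.restrict B), (ψ₁ + ψ₂ : L2 A) (c * s) = ψ₁ (c * s) + ψ₂ (c * s) := by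
      refine ae_of_ae_map (f := fun s => c * s) (p := fun t => (ψ₁ + ψ₂ : L2 A) t = ψ₁ t + ψ₂ t)
        hq.aemeasurable ?_
      rw [map_mul_restrict hc hB]
      exact Measure.ae_smul_measure (Lp.coeFn_add ψ₁ ψ₂) _
    filter_upwards [e, MemLp.coeFn_toLp (eLpNorm_dilate hc hB ψ₁).1,
      MemLp.coeFn_toLp (eLpNorm_dilate hc hB ψ₂).1,
      MemLp.coeFn_toLp (eLpNorm_dilate hc hB (ψ₁ + ψ₂)).1, Lp.coeFn_add
        ((eLpNorm_dilate hc hB ψ₁).1.toLp _) ((eLpNorm_dilate hc hB ψ₂).1.toLp _)]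
      with s a0 a1 a2 a3 a4
    rw [a3, a4, Pi.add_apply, a1, a2, a0, mul_add]
  map_smul' a ψ := by
    refine Lp.ext ?_
    have hq := (Homeomorph.mulLeft₀ c hc.ne').measurableEmbedding.measurable
    have e : ∀ᵐ s ∂(volume.restrict B), (a • ψ : L2 A) (c * s) = a * ψ (c * s) := by
      refine ae_of_ae_map (f := fun s => c * s) (p := fun t => (a • ψ : L2 A) t = a * ψ t)
        hq.aemeasurable ?_
      rw [map_mul_restrict hc hB]
      exact Measure.ae_smul_measure (Lp.coeFn_smul a ψ) _
    filter_upwards [e, MemLp.coeFn_toLp (eLpNorm_dilate hc hB ψ).1,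
      MemLp.coeFn_toLp (eLpNorm_dilate hc hB (a • ψ)).1, Lp.coeFn_smul a
        ((eLpNorm_dilate hc hB ψ).1.toLp _)] with s a0 a1 a2 a3
    rw [a2, RingHom.id_apply, a3, Pi.smul_apply, a1, a0, smul_eq_mul]
    ring
  norm_map' ψ := by
    change ‖(eLpNorm_dilate hc hB ψ).1.toLp _‖ = ‖ψ‖
    rw [Lp.norm_toLp, (eLpNorm_dilate hc hB ψ).2, Lp.norm_def]

theorem dilate_coeFn {A B : Set ℝ} {c : ℝ} (hc : 0 < c) (hB : (fun s => c * s) ⁻¹' A = B)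
    (ψ : L2 A) : dilate hc hB ψ =ᵐ[volume.restrict B] fun s => ((√c : ℝ) : ℂ) * ψ (c * s) :=
  MemLp.coeFn_toLp (eLpNorm_dilate hc hB ψ).1

theorem dilate_dilate {A B : Set ℝ} {c d : ℝ} (hc : 0 < c) (hd : 0 < d) (hcd : c * d = 1)
    (hB : (fun s => c * s) ⁻¹' A = B) (hA : (fun s => d * s) ⁻¹' B = A) (ψ : L2 A) :
    dilate hd hA (dilate hc hB ψ) = ψ := by
  refine Lp.ext ?_
  have hq := (Homeomorph.mulLeft₀ d hd.ne').measurableEmbedding.measurable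
  have e : ∀ᵐ s ∂(volume.restrict A),
      (dilate hc hB ψ) (d * s) = ((√c : ℝ) : ℂ) * ψ (c * (d * s)) := by
    refine ae_of_ae_map (f := fun s => d * s)
      (p := fun t => (dilate hc hB ψ) t = ((√c : ℝ) : ℂ) * ψ (c * t)) hq.aemeasurable ?_
    rw [map_mul_restrict hd hA]
    exact Measure.ae_smul_measure (dilate_coeFn hc hB ψ) _
  filter_upwards [e, dilate_coeFn hd hA (dilate hc hB ψ)] with s a0 a1
  rw [a1, a0, ← mul_assoc c, hcd, one_mul, ← mul_assoc, ← Complex.ofReal_mul,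
    ← Real.sqrt_mul hd.le, mul_comm d, hcd, Real.sqrt_one, Complex.ofReal_one, one_mul]

/-- `I_ε = (-a ε^{-1/2}, b ε^{-1/2})`. -/
def scaledInterval (a b ε : ℝ) : Set ℝ := Ioo (-a / √ε) (b / √ε)

theorem preimage_interval {ε : ℝ} (a b : ℝ) (hε : 0 < ε) :
    (fun s => √ε * s) ⁻¹' Ioo (-a) b = scaledInterval a b ε := by
  have h := Real.sqrt_pos.2 hε
  ext s
  simp only [scaledInterval, mem_preimage, mem_Ioo, div_lt_iff₀ h, lt_div_iff₀ h, mul_comm s]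

theorem preimage_scaled {ε : ℝ} (a b : ℝ) (hε : 0 < ε) :
    (fun s => (√ε)⁻¹ * s) ⁻¹' scaledInterval a b ε = Ioo (-a) b := by
  have h := Real.sqrt_pos.2 hε
  rw [← preimage_interval a b hε, ← preimage_comp]
  ext s
  simp [h.ne']

/-- The unitary dilation `J_ε : L²(I) → L²(I_ε)`, `(J_ε ψ)(s) = ε^{1/4} ψ(ε^{1/2} s)`, where
`I = (-a, b)`; see `dilation_coeFn`. -/
def dilation (a b : ℝ) {ε : ℝ} (hε : 0 < ε) :
    L2 (Ioo (-a) b) ≃ₗᵢ[ℂ] L2 (scaledInterval a b ε) where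
  toLinearEquiv := LinearEquiv.ofLinearMap
    (dilate (Real.sqrt_pos.2 hε) (preimage_interval a b hε)).toLinearMap
    (dilate (inv_pos.2 (Real.sqrt_pos.2 hε)) (preimage_scaled a b hε)).toLinearMap
    (by
      refine LinearMap.ext fun ψ => ?_
      exact dilate_dilate (inv_pos.2 (Real.sqrt_pos.2 hε)) (Real.sqrt_pos.2 hε)
        (inv_mul_cancel₀ (Real.sqrt_pos.2 hε).ne') (preimage_scaled a b hε)
        (preimage_interval a b hε) ψ)
    (by
      refine LinearMap.ext fun ψ => ?_
      exact dilate_dilate (Real.sqrt_pos.2 hε) (inv_pos.2 (Real.sqrt_pos.2 hε))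
        (mul_inv_cancel₀ (Real.sqrt_pos.2 hε).ne') (preimage_interval a b hε)
        (preimage_scaled a b hε) ψ)
  norm_map' ψ := (dilate (Real.sqrt_pos.2 hε) (preimage_interval a b hε)).norm_map ψ

theorem dilation_coeFn (a b : ℝ) {ε : ℝ} (hε : 0 < ε) (ψ : L2 (Ioo (-a) b)) :
    dilation a b hε ψ =ᵐ[volume.restrict (scaledInterval a b ε)]
      fun s => ((ε ^ (1 / 4 : ℝ) : ℝ) : ℂ) * ψ (√ε * s) := by
  have h : √(√ε) = ε ^ (1 / 4 : ℝ) := by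
    rw [Real.sqrt_eq_rpow, Real.sqrt_eq_rpow, ← Real.rpow_mul hε.le]; norm_num
  rw [← h]
  exact dilate_coeFn (Real.sqrt_pos.2 hε) (preimage_interval a b hε) ψ

/-- `t J A J⁻¹`, an unbounded operator in `K` with domain `J (dom A)`, for an unbounded operator
`A` in `H`, a unitary `J : H → K` and a scalar `t`. -/
def conjScale {H K : Type*} [NormedAddCommGroup H] [NormedSpace ℂ H] [NormedAddCommGroup K]
    [NormedSpace ℂ K] (J : H ≃ₗᵢ[ℂ] K) (t : ℂ) (A : H →ₗ.[ℂ] H) : K →ₗ.[ℂ] K where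
  domain := A.domain.comap J.symm.toLinearEquiv.toLinearMap
  toFun :=
    { toFun := fun v => t • J (A ⟨J.symm v, v.2⟩)
      map_add' := by
        intro v w
        rw [← smul_add, ← map_add, ← LinearPMap.map_add]
        congr 3
        exact Subtype.ext (map_add J.symm _ _)
      map_smul' := by
        intro c v
        have e : (⟨J.symm (c • v : K), (c • v).2⟩ : A.domain) = c • ⟨J.symm v, v.2⟩ :=
          Subtype.ext (map_smul J.symm c (v : K))
        refine (congrArg (fun x => t • J (A x)) e).trans ?_
        rw [RingHom.id_apply, smul_comm c, LinearPMap.map_smul, map_smul J] }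

/-! ### Extension by zero -/

theorem memLp_restrict (Ω : Set ℝ) (f : L2 univ) : MemLp f 2 (volume.restrict Ω) :=
  (Lp.memLp f).mono_measure (Measure.restrict_mono (subset_univ Ω) le_rfl)

theorem ae_restrict_of_univ (Ω : Set ℝ) {p : ℝ → Prop} (h : ∀ᵐ s ∂(volume.restrict univ), p s) :
    ∀ᵐ s ∂(volume.restrict Ω), p s :=
  (Measure.restrict_mono (subset_univ Ω) le_rfl).absolutelyContinuous.ae_le h

/-- Restriction `L²(ℝ) → L²(Ω)`. -/
def restrictL2 (Ω : Set ℝ) : L2 univ →L[ℂ] L2 Ω :=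
  LinearMap.mkContinuous
    { toFun := fun f => (memLp_restrict Ω f).toLp f
      map_add' := by
        intro f g
        rw [← MemLp.toLp_add]
        exact MemLp.toLp_congr _ _ (ae_restrict_of_univ Ω (Lp.coeFn_add f g))
      map_smul' := by
        intro c f
        rw [RingHom.id_apply, ← MemLp.toLp_const_smul]
        exact MemLp.toLp_congr _ _ (ae_restrict_of_univ Ω (Lp.coeFn_smul c f)) } 1 (by
    intro f
    rw [one_mul]
    change ‖(memLp_restrict Ω f).toLp f‖ ≤ ‖f‖
    rw [Lp.norm_toLp, Lp.norm_def]
    exact ENNReal.toReal_mono (Lp.eLpNorm_ne_top f)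
      (eLpNorm_mono_measure _ (Measure.restrict_mono (subset_univ Ω) le_rfl)))

theorem memLp_extend {Ω : Set ℝ} (hΩ : MeasurableSet Ω) (f : L2 Ω) :
    MemLp (Ω.indicator f) 2 (volume.restrict univ) := by
  rw [Measure.restrict_univ, memLp_indicator_iff_restrict hΩ]
  exact Lp.memLp f

theorem ae_indicator {Ω : Set ℝ} (hΩ : MeasurableSet Ω) {f g : ℝ → ℂ}
    (h : f =ᵐ[volume.restrict Ω] g) :
    Ω.indicator f =ᵐ[volume.restrict univ] Ω.indicator g := by
  rw [Measure.restrict_univ]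
  filter_upwards [(ae_restrict_iff' hΩ).1 h] with s hs
  by_cases hm : s ∈ Ω
  · rw [indicator_of_mem hm, indicator_of_mem hm, hs hm]
  · rw [indicator_of_notMem hm, indicator_of_notMem hm]

/-- Extension by zero `L²(Ω) → L²(ℝ)`. -/
def extendL2 {Ω : Set ℝ} (hΩ : MeasurableSet Ω) : L2 Ω →L[ℂ] L2 univ :=
  LinearMap.mkContinuous
    { toFun := fun f => (memLp_extend hΩ f).toLp (Ω.indicator f)
      map_add' := by
        intro f g
        rw [← MemLp.toLp_add]
        refine MemLp.toLp_congr _ _ ((ae_indicator hΩ (Lp.coeFn_add f g)).trans ?_)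
        rw [indicator_add']
      map_smul' := by
        intro c f
        rw [RingHom.id_apply, ← MemLp.toLp_const_smul]
        refine MemLp.toLp_congr _ _ ((ae_indicator hΩ (Lp.coeFn_smul c f)).trans ?_)
        refine Eventually.of_forall fun s => ?_
        exact indicator_const_smul_apply Ω c (f : ℝ → ℂ) s } 1 (by
    intro f
    rw [one_mul]
    change ‖(memLp_extend hΩ f).toLp (Ω.indicator f)‖ ≤ ‖f‖
    rw [Lp.norm_toLp, Lp.norm_def, Measure.restrict_univ, eLpNorm_indicator_eq_eLpNorm_restrict hΩ])

/-- `B ⊕ 0` on `L²(ℝ) = L²(Ω) ⊕ L²(ℝ \ Ω)`. -/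
def sumZero {Ω : Set ℝ} (hΩ : MeasurableSet Ω) (B : L2 Ω →L[ℂ] L2 Ω) :
    L2 univ →L[ℂ] L2 univ :=
  extendL2 hΩ ∘L B ∘L restrictL2 Ω

theorem measurableSet_scaledInterval (a b ε : ℝ) : MeasurableSet (scaledInterval a b ε) :=
  measurableSet_Ioo

end ThinTube

end

/-! After the dilation, $\hat T_{\varepsilon,c}$ is the Dirichlet operator $-d^2/ds^2+V_\varepsilon$
on $I_\varepsilon$ with $V_\varepsilon(s)=\varepsilon W_\varepsilon(\sqrt\varepsilon s)$. Put
$p=1/h^2-1/M^2$. Two properties of $p$ carry the theorem. Near $0$, $p(t)=2t^2/M^3+O(|t|^3)$, so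
$V_\varepsilon$ differs from $V=2\lambda_0s^2/M^3$ by
$O(\varepsilon+\sqrt\varepsilon|s|^3+\varepsilon s^2)$, which is small on each fixed bounded
interval. On all of $I$, uniqueness of the maximum and compactness give $p(t)\ge\delta t^2$, so
$V_\varepsilon\ge\beta s^2-\varepsilon A$ with $\beta>0$ independent of $\varepsilon$
(`exists_effPotential_bounds`). Here $\lambda_0>0$ is needed; it follows from a Poincaré inequality
(`IsDirichletGroundState.eigenvalue_pos`).

The uncertainty principle $\|u\|^2\le\|u'\|^2+\frac32\|su\|^2$ makes the form of $-u''+\beta s^2u$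
coercive, also after adding a bounded $m$ with a small negative part. Lax-Milgram on the form domain
gives weak solutions, a truncated multiplier argument gives $s^2u\in L^2$ and hence the operator
domain, and $\|u\|,\|u'\|,\|su\|\le K\|f\|$ with $K$ depending on $\beta$ only
(`exists_schrodinger_inverse`). These bounds are uniform in $\varepsilon$.

To compare $u=T^{-1}f$ with $w=\hat T_{\varepsilon,c}^{-1}(g|_{I_\varepsilon})$, each equation is
tested with the other solution times a cutoff $\chi$ that is $1$ on $[-L,L]$ and supported in
$[-2L,2L]$ (`norm_inner_sub_le`). The leading terms cancel. Removing $\chi$ costs $O(1/L)$ by the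
bounds on $su$ and $sw$, the commutator terms with $\chi'$ cost $O(1/L)$, and the potentials
contribute $\sup|\chi(V-V_\varepsilon)|$. Choosing $g=(\hat T_{\varepsilon,c}^{-1}\oplus0-T^{-1})f$
turns this into an operator norm bound (`norm_sumZero_sub_le`). First $L$ is taken large, then
$\varepsilon$ small. -/

noncomputable section

namespace ThinTube

open scoped InnerProductSpace ComplexConjugate

/-! ### Bounded multipliers and inner products on `L²(Ω)` -/

/-- Multiplication by the essentially bounded real function `m` on `L²(Ω)`. -/
def mulL2 {Ω : Set ℝ} {m : ℝ → ℝ} (hm : MemLp (fun s => (m s : ℂ)) ∞ (volume.restrict Ω)) :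
    L2 Ω →L[ℂ] L2 Ω :=
  (ContinuousLinearMap.mul ℂ ℂ).holderL (volume.restrict Ω) ∞ 2 2 (hm.toLp _)

theorem mulL2_coeFn {Ω : Set ℝ} {m : ℝ → ℝ}
    (hm : MemLp (fun s => (m s : ℂ)) ∞ (volume.restrict Ω)) (u : L2 Ω) :
    mulL2 hm u =ᵐ[volume.restrict Ω] fun s => (m s : ℂ) * u s := by
  have h := (ContinuousLinearMap.mul ℂ ℂ).coeFn_holder (r := 2) (hm.toLp _) u
  filter_upwards [h, hm.coeFn_toLp] with s h1 h2
  rw [← h2]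
  exact h1

theorem memLp_top_of_continuous_of_bound (Ω : Set ℝ) {m : ℝ → ℝ} (hc : Continuous m) {C : ℝ}
    (hb : ∀ s, |m s| ≤ C) : MemLp (fun s => (m s : ℂ)) ∞ (volume.restrict Ω) :=
  memLp_top_of_bound (Complex.continuous_ofReal.comp hc).aestronglyMeasurable C
    (.of_forall fun s => by simpa using hb s)

theorem inner_eq_integral {Ω : Set ℝ} {u v : L2 Ω} {f g : ℝ → ℂ}
    (hu : u =ᵐ[volume.restrict Ω] f) (hv : v =ᵐ[volume.restrict Ω] g) :
    ⟪u, v⟫_ℂ = ∫ s in Ω, g s * conj (f s) := by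
  rw [L2.inner_def]
  refine integral_congr_ae ?_
  filter_upwards [hu, hv] with s h1 h2
  rw [h1, h2, RCLike.inner_apply]

theorem inner_congr {Ω : Set ℝ} {u v w z : L2 Ω}
    (h : ∀ᵐ s ∂(volume.restrict Ω), v s * conj (u s) = z s * conj (w s)) :
    ⟪u, v⟫_ℂ = ⟪w, z⟫_ℂ := by
  rw [inner_eq_integral (ae_eq_refl _) (ae_eq_refl _),
    inner_eq_integral (ae_eq_refl _) (ae_eq_refl _)]
  exact integral_congr_ae h

theorem re_inner_le_of_ae {Ω : Set ℝ} {u v w z : L2 Ω}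
    (h : ∀ᵐ s ∂(volume.restrict Ω), (v s * conj (u s)).re ≤ (z s * conj (w s)).re) :
    (⟪u, v⟫_ℂ).re ≤ (⟪w, z⟫_ℂ).re := by
  have key : ∀ p q : L2 Ω, (⟪p, q⟫_ℂ).re = ∫ s in Ω, (q s * conj (p s)).re := fun p q => by
    have hi := L2.integrable_inner (𝕜 := ℂ) p q
    rw [L2.inner_def]
    exact (integral_re hi).symm
  have hint : ∀ p q : L2 Ω, Integrable (fun s => (q s * conj (p s)).re) (volume.restrict Ω) :=
    fun p q => (L2.integrable_inner (𝕜 := ℂ) p q).re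
  rw [key, key]
  exact integral_mono_ae (hint _ _) (hint _ _) h

theorem norm_le_of_ae {Ω : Set ℝ} {u v : L2 Ω} {C : ℝ}
    (h : ∀ᵐ s ∂(volume.restrict Ω), ‖u s‖ ≤ C * ‖v s‖) : ‖u‖ ≤ C * ‖v‖ :=
  Lp.norm_le_mul_norm_of_ae_le_mul h

theorem norm_mulL2_le {Ω : Set ℝ} {m : ℝ → ℝ}
    (hm : MemLp (fun s => (m s : ℂ)) ∞ (volume.restrict Ω)) {C : ℝ}
    (h : ∀ᵐ s ∂(volume.restrict Ω), |m s| ≤ C) (u : L2 Ω) : ‖mulL2 hm u‖ ≤ C * ‖u‖ := by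
  refine norm_le_of_ae ?_
  filter_upwards [h, mulL2_coeFn hm u] with s h1 h2
  rw [h2, norm_mul, Complex.norm_real]
  exact mul_le_mul_of_nonneg_right h1 (norm_nonneg _)

theorem inner_mulL2 {Ω : Set ℝ} {m : ℝ → ℝ}
    (hm : MemLp (fun s => (m s : ℂ)) ∞ (volume.restrict Ω)) (u v : L2 Ω) :
    ⟪mulL2 hm u, v⟫_ℂ = ⟪u, mulL2 hm v⟫_ℂ := by
  refine inner_congr ?_
  filter_upwards [mulL2_coeFn hm u, mulL2_coeFn hm v] with s h1 h2
  rw [h1, h2, map_mul, Complex.conj_ofReal]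
  ring

/-! ### Test functions and the space `H_0^1(Ω)` -/

theorem IsTest.memLp {Ω : Set ℝ} {φ : ℝ → ℂ} (hφ : IsTest Ω φ) (Ω' : Set ℝ) :
    MemLp φ 2 (volume.restrict Ω') :=
  hφ.1.continuous.memLp_of_hasCompactSupport hφ.2.1

theorem IsTest.continuous_deriv {Ω : Set ℝ} {φ : ℝ → ℂ} (hφ : IsTest Ω φ) :
    Continuous (deriv φ) :=
  hφ.1.continuous_deriv (by simp)

theorem IsTest.memLp_deriv {Ω : Set ℝ} {φ : ℝ → ℂ} (hφ : IsTest Ω φ) (Ω' : Set ℝ) :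
    MemLp (deriv φ) 2 (volume.restrict Ω') :=
  hφ.continuous_deriv.memLp_of_hasCompactSupport hφ.2.1.deriv

theorem IsTest.hasDerivAt {Ω : Set ℝ} {φ : ℝ → ℂ} (hφ : IsTest Ω φ) (s : ℝ) :
    HasDerivAt φ (deriv φ s) s :=
  (hφ.1.differentiable (by simp) s).hasDerivAt

theorem IsTest.conj {Ω : Set ℝ} {φ : ℝ → ℂ} (hφ : IsTest Ω φ) :
    IsTest Ω (fun s => conj (φ s)) :=
  ⟨Complex.conjCLE.contDiff.comp hφ.1, hφ.2.1.comp_left (g := conj) (map_zero _),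
    (tsupport_comp_subset (g := conj) (map_zero _) φ).trans hφ.2.2⟩

theorem IsTest.deriv_conj {Ω : Set ℝ} {φ : ℝ → ℂ} (hφ : IsTest Ω φ) (s : ℝ) :
    deriv (fun s => conj (φ s)) s = conj (deriv φ s) :=
  ((Complex.conjCLE.hasFDerivAt (x := φ s)).comp_hasDerivAt s (hφ.hasDerivAt s)).deriv

theorem IsTest.mono {Ω Ω' : Set ℝ} {φ : ℝ → ℂ} (hφ : IsTest Ω φ) (h : Ω ⊆ Ω') : IsTest Ω' φ :=
  ⟨hφ.1, hφ.2.1, hφ.2.2.trans h⟩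

theorem IsTest.eq_zero {Ω : Set ℝ} {φ : ℝ → ℂ} (hφ : IsTest Ω φ) {s : ℝ} (hs : s ∉ Ω) :
    φ s = 0 :=
  image_eq_zero_of_notMem_tsupport fun h => hs (hφ.2.2 h)

theorem IsTest.deriv_eq_zero {Ω : Set ℝ} {φ : ℝ → ℂ} (hφ : IsTest Ω φ) {s : ℝ} (hs : s ∉ Ω) :
    deriv φ s = 0 :=
  image_eq_zero_of_notMem_tsupport fun h => hs (hφ.2.2 (tsupport_deriv_subset h))

theorem IsTest.mul_ofReal {Ω : Set ℝ} {φ : ℝ → ℂ} (hφ : IsTest Ω φ) {g : ℝ → ℝ}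
    (hg : ContDiff ℝ ∞ g) : IsTest Ω (fun s => (g s : ℂ) * φ s) :=
  ⟨(Complex.ofRealCLM.contDiff.comp hg).mul hφ.1, hφ.2.1.mul_left,
    (tsupport_mul_subset_right (f := fun s => (g s : ℂ)) (g := φ)).trans hφ.2.2⟩

theorem deriv_ofReal_mul {g : ℝ → ℝ} {g' s : ℝ} (hg : HasDerivAt g g' s) {φ : ℝ → ℂ} {φ' : ℂ}
    (hφ : HasDerivAt φ φ' s) :
    deriv (fun s => (g s : ℂ) * φ s) s = (g' : ℂ) * φ s + (g s : ℂ) * φ' :=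
  (hg.ofReal_comp.mul hφ).deriv

theorem IsTest.integral_mul_deriv {Ω : Set ℝ} {φ ψ : ℝ → ℂ} (hφ : IsTest Ω φ) (hψ : IsTest Ω ψ) :
    ∫ s in Ω, φ s * deriv ψ s = -∫ s in Ω, deriv φ s * ψ s := by
  rw [setIntegral_eq_integral_of_forall_compl_eq_zero
      (fun s hs => by rw [hφ.eq_zero hs, zero_mul]),
    setIntegral_eq_integral_of_forall_compl_eq_zero
      (fun s hs => by rw [hψ.eq_zero hs, mul_zero])]
  refine integral_mul_deriv_eq_deriv_mul_of_integrable (fun s _ => hφ.hasDerivAt s)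
    (fun s _ => hψ.hasDerivAt s) ?_ ?_ ?_
  · exact (hφ.1.continuous.mul hψ.continuous_deriv).integrable_of_hasCompactSupport hφ.2.1.mul_right
  · exact (hφ.continuous_deriv.mul hψ.1.continuous).integrable_of_hasCompactSupport hψ.2.1.mul_left
  · exact (hφ.1.continuous.mul hψ.1.continuous).integrable_of_hasCompactSupport hφ.2.1.mul_right

/-- The pairs `(φ, φ')` in `L²(Ω) × L²(Ω)` with `φ ∈ C_c^∞(Ω)`. -/
def testPairs (Ω : Set ℝ) : Set (L2 Ω × L2 Ω) :=
  {p | ∃ φ : ℝ → ℂ, IsTest Ω φ ∧ p.1 =ᵐ[volume.restrict Ω] φ ∧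
    p.2 =ᵐ[volume.restrict Ω] deriv φ}

theorem integral_eq_inner {Ω : Set ℝ} {ψ : ℝ → ℂ} {q : L2 Ω}
    (hq : q =ᵐ[volume.restrict Ω] fun s => conj (ψ s)) (u : L2 Ω) :
    ∫ s in Ω, u s * ψ s = ⟪q, u⟫_ℂ := by
  rw [inner_eq_integral hq (ae_eq_refl _)]
  simp

/-- Conjugation preserves test functions, so the bilinear pairing in the definition can be traded
for the inner product. Each condition is then closed in $(u,u')$ and passes to limits. -/
theorem isWeakDeriv_iff {Ω : Set ℝ} {u u' : L2 Ω} :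
    IsWeakDeriv Ω u u' ↔ ∀ p ∈ testPairs Ω, ⟪p.2, u⟫_ℂ = -⟪p.1, u'⟫_ℂ := by
  constructor
  · rintro h ⟨p, q⟩ ⟨φ, hφ, hp, hq⟩
    have := h _ hφ.conj
    rw [integral_eq_inner (q := q), integral_eq_inner (q := p)] at this
    · exact this
    · simpa using hp
    · refine hq.trans (.of_forall fun s => ?_)
      simp [hφ.deriv_conj]
  · intro h φ hφ
    have h1 := (hφ.conj.memLp Ω).coeFn_toLp
    have h2 := (hφ.conj.memLp_deriv Ω).coeFn_toLp
    rw [integral_eq_inner h1,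
      integral_eq_inner (h2.trans (.of_forall fun s => by simp [hφ.deriv_conj]))]
    exact h ⟨_, _⟩ ⟨_, hφ.conj, h1, h2⟩

theorem IsTest.isWeakDeriv {Ω : Set ℝ} {p : L2 Ω × L2 Ω} (hp : p ∈ testPairs Ω) :
    IsWeakDeriv Ω p.1 p.2 := by
  obtain ⟨φ, hφ, h1, h2⟩ := hp
  intro ψ hψ
  rw [integral_congr_ae (g := fun s => φ s * deriv ψ s)
      (by filter_upwards [h1] with s hs; rw [hs]),
    integral_congr_ae (f := fun s => p.2 s * ψ s) (g := fun s => deriv φ s * ψ s)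
      (by filter_upwards [h2] with s hs; rw [hs])]
  exact hφ.integral_mul_deriv hψ

theorem isWeakDeriv_of_mem_closure {Ω : Set ℝ} {p : L2 Ω × L2 Ω}
    (hp : p ∈ closure (testPairs Ω)) : IsWeakDeriv Ω p.1 p.2 := by
  rw [isWeakDeriv_iff]
  intro q hq
  have hcl : IsClosed {p : L2 Ω × L2 Ω | ⟪q.2, p.1⟫_ℂ = -⟪q.1, p.2⟫_ℂ} :=
    isClosed_eq (by fun_prop) (by fun_prop)
  exact closure_minimal (fun p hp => isWeakDeriv_iff.1 (IsTest.isWeakDeriv hp) q hq) hcl hp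

/-- The weak derivative condition in `IsH01` is automatic for limits of test pairs. Statements about
$H_0^1$ thus reduce, by continuity, to statements about test functions. -/
theorem isH01_iff {Ω : Set ℝ} {u u' : L2 Ω} :
    IsH01 Ω u u' ↔ (u, u') ∈ closure (testPairs Ω) := by
  have key : ∀ (φ : ℕ → ℝ → ℂ) (P : ℕ → L2 Ω) (v : L2 Ω),
      (∀ n, P n =ᵐ[volume.restrict Ω] φ n) →
      (Tendsto (fun n => eLpNorm (fun s => φ n s - v s) 2 (volume.restrict Ω)) atTop (𝓝 0) ↔
        Tendsto P atTop (𝓝 v)) := by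
    intro φ P v hP
    rw [Lp.tendsto_Lp_iff_tendsto_eLpNorm']
    refine tendsto_congr fun n => eLpNorm_congr_ae ?_
    filter_upwards [hP n] with s hs
    rw [Pi.sub_apply, hs]
  constructor
  · rintro ⟨-, φ, hφ, h1, h2⟩
    have e1 := fun n => ((hφ n).memLp Ω).coeFn_toLp
    have e2 := fun n => ((hφ n).memLp_deriv Ω).coeFn_toLp
    rw [key _ _ _ e1] at h1
    rw [key _ _ _ e2] at h2
    exact mem_closure_of_tendsto (h1.prodMk_nhds h2)
      (.of_forall fun n => ⟨φ n, hφ n, e1 n, e2 n⟩)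
  · intro h
    refine ⟨isWeakDeriv_of_mem_closure h, ?_⟩
    obtain ⟨x, hx, hlim⟩ := mem_closure_iff_seq_limit.1 h
    choose φ hφ e1 e2 using hx
    rw [Prod.tendsto_iff] at hlim
    exact ⟨φ, hφ, (key _ _ _ e1).2 hlim.1, (key _ _ _ e2).2 hlim.2⟩

/-- Integration by parts for `-u'' + V u = f` against an element of `H_0^1(Ω)`. -/
theorem inner_of_isWeakDeriv {Ω : Set ℝ} {u' u'' v v' : L2 Ω} (hu : IsWeakDeriv Ω u' u'')
    (hv : IsH01 Ω v v') : ⟪v', u'⟫_ℂ = -⟪v, u''⟫_ℂ := by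
  have hcl : IsClosed {p : L2 Ω × L2 Ω | ⟪p.2, u'⟫_ℂ = -⟪p.1, u''⟫_ℂ} :=
    isClosed_eq (by fun_prop) (by fun_prop)
  exact closure_minimal (fun p hp => isWeakDeriv_iff.1 hu p hp) hcl (isH01_iff.1 hv)

/-- The product rule in `H_0^1(Ω)`. -/
theorem IsH01.mul {Ω : Set ℝ} {u u' : L2 Ω} (hu : IsH01 Ω u u') {g g' : ℝ → ℝ}
    (hg : ContDiff ℝ ∞ g) (hg' : ∀ s, HasDerivAt g (g' s) s)
    (hb : MemLp (fun s => (g s : ℂ)) ∞ (volume.restrict Ω))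
    (hb' : MemLp (fun s => (g' s : ℂ)) ∞ (volume.restrict Ω)) :
    IsH01 Ω (mulL2 hb u) (mulL2 hb' u + mulL2 hb u') := by
  rw [isH01_iff] at hu ⊢
  refine map_mem_closure (f := fun p : L2 Ω × L2 Ω =>
    (mulL2 hb p.1, mulL2 hb' p.1 + mulL2 hb p.2)) (by fun_prop) hu ?_
  rintro ⟨p, q⟩ ⟨φ, hφ, h1, h2⟩
  refine ⟨_, hφ.mul_ofReal hg, ?_, ?_⟩
  · filter_upwards [mulL2_coeFn hb p, h1] with s e1 e2
    rw [e1, ← e2]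
  · filter_upwards [mulL2_coeFn hb' p, mulL2_coeFn hb q, h1, h2,
      Lp.coeFn_add (mulL2 hb' p) (mulL2 hb q)] with s e1 e2 e3 e4 e5
    rw [deriv_ofReal_mul (hg' s) (hφ.hasDerivAt s), ← e4]
    rw [← e3, e5, Pi.add_apply, e1, e2]

theorem memLp_top_sin (Ω : Set ℝ) : MemLp (fun s => (Real.sin s : ℂ)) ∞ (volume.restrict Ω) :=
  memLp_top_of_continuous_of_bound Ω Real.continuous_sin Real.abs_sin_le_one

theorem memLp_top_cos (Ω : Set ℝ) : MemLp (fun s => (Real.cos s : ℂ)) ∞ (volume.restrict Ω) :=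
  memLp_top_of_continuous_of_bound Ω Real.continuous_cos Real.abs_cos_le_one

/-- `∫ cos |u|² ≤ ∫ |u'|² + ∫ sin² |u|²`. -/
theorem IsH01.re_inner_cos_le {Ω : Set ℝ} {u u' : L2 Ω} (hu : IsH01 Ω u u') :
    (⟪u, mulL2 (memLp_top_cos Ω) u⟫_ℂ).re ≤ ‖u'‖ ^ 2 + ‖mulL2 (memLp_top_sin Ω) u‖ ^ 2 := by
  -- This is the commutator argument for the uncertainty principle with the bounded field $\sin s$
  -- instead of $s$: testing with $\sin(s)u$ gives $\int\cos|u|^2=-2\,\mathrm{Re}\langle\sin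
  -- u,u'\rangle$.
  have h1 := inner_of_isWeakDeriv hu.1 (hu.mul Real.contDiff_sin Real.hasDerivAt_sin
    (memLp_top_sin Ω) (memLp_top_cos Ω))
  have h2 := congrArg Complex.re h1
  have h3 : ⟪mulL2 (memLp_top_sin Ω) u', u⟫_ℂ = ⟪u', mulL2 (memLp_top_sin Ω) u⟫_ℂ :=
    inner_mulL2 _ _ _
  have h4 : (⟪u', mulL2 (memLp_top_sin Ω) u⟫_ℂ).re = (⟪mulL2 (memLp_top_sin Ω) u, u'⟫_ℂ).re := by
    rw [← inner_conj_symm, Complex.conj_re]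
  rw [inner_add_left, h3, inner_mulL2] at h2
  simp only [Complex.add_re, Complex.neg_re, h4] at h2
  have h5 := Complex.abs_re_le_norm ⟪mulL2 (memLp_top_sin Ω) u, u'⟫_ℂ
  have h6 := norm_inner_le_norm (𝕜 := ℂ) (mulL2 (memLp_top_sin Ω) u) u'
  have h7 := neg_abs_le (⟪mulL2 (memLp_top_sin Ω) u, u'⟫_ℂ).re
  nlinarith [sq_nonneg (‖mulL2 (memLp_top_sin Ω) u‖ - ‖u'‖)]

theorem re_mul_conj_self (z : ℂ) : (z * conj z).re = ‖z‖ ^ 2 := by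
  rw [Complex.mul_conj, Complex.ofReal_re, Complex.normSq_eq_norm_sq]

theorem re_inner_self (Ω : Set ℝ) (u : L2 Ω) : (⟪u, u⟫_ℂ).re = ‖u‖ ^ 2 :=
  (norm_sq_eq_re_inner (𝕜 := ℂ) u).symm

/-- A form of the uncertainty principle. -/
theorem IsH01.norm_sq_le {Ω : Set ℝ} {u u' w : L2 Ω} (hu : IsH01 Ω u u')
    (hw : w =ᵐ[volume.restrict Ω] fun s => (s : ℂ) * u s) :
    ‖u‖ ^ 2 ≤ ‖u'‖ ^ 2 + 3 / 2 * ‖w‖ ^ 2 := by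
  -- Write $1=\cos s+2\sin^2(s/2)$. The bounds $\sin^2 s\le s^2$ and $2\sin^2(s/2)\le s^2/2$ add up
  -- to the factor $3/2$.
  have h1 := hu.re_inner_cos_le
  have h2 : ‖mulL2 (memLp_top_sin Ω) u‖ ≤ 1 * ‖w‖ := by
    refine norm_le_of_ae ?_
    filter_upwards [mulL2_coeFn (memLp_top_sin Ω) u, hw] with s e1 e2
    rw [e1, e2, one_mul, norm_mul, norm_mul, Complex.norm_real, Complex.norm_real]
    exact mul_le_mul_of_nonneg_right Real.abs_sin_le_abs (norm_nonneg _)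
  have hm := memLp_top_of_continuous_of_bound Ω (m := fun s => Real.sin (s / 2))
    (by fun_prop) fun s => Real.abs_sin_le_one _
  set q := mulL2 hm with hq
  have h3 : ‖q u‖ ≤ 1 / 2 * ‖w‖ := by
    refine norm_le_of_ae ?_
    filter_upwards [mulL2_coeFn _ u, hw] with s e1 e2
    rw [e1, e2, norm_mul, norm_mul, Complex.norm_real, Complex.norm_real, ← mul_assoc]
    refine mul_le_mul_of_nonneg_right (Real.abs_sin_le_abs.trans ?_) (norm_nonneg _)
    rw [abs_div, abs_two, Real.norm_eq_abs]
    linarith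
  have h4 : u = mulL2 (memLp_top_cos Ω) u + (2 : ℂ) • q (q u) := by
    refine Lp.ext ?_
    filter_upwards [mulL2_coeFn (memLp_top_cos Ω) u, mulL2_coeFn hm u, mulL2_coeFn hm (q u),
      Lp.coeFn_add (mulL2 (memLp_top_cos Ω) u) ((2 : ℂ) • q (q u)),
      Lp.coeFn_smul (2 : ℂ) (q (q u))] with s e1 e2 e3 e4 e5
    rw [e4, Pi.add_apply, e5, Pi.smul_apply, e3, e2, e1, smul_eq_mul]
    have : Real.cos s = 1 - 2 * Real.sin (s / 2) ^ 2 := by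
      have h := Real.cos_two_mul (s / 2)
      rw [mul_div_cancel₀ s two_ne_zero] at h
      linarith [Real.sin_sq_add_cos_sq (s / 2)]
    rw [this]
    push_cast
    ring
  have h5 : ‖u‖ ^ 2 = (⟪u, mulL2 (memLp_top_cos Ω) u⟫_ℂ).re + 2 * ‖q u‖ ^ 2 := by
    rw [← re_inner_self]
    nth_rw 2 [h4]
    rw [inner_add_right, inner_smul_right, ← inner_mulL2 hm, ← hq, Complex.add_re, ← re_inner_self]
    simp
  have h6 : ‖mulL2 (memLp_top_sin Ω) u‖ ^ 2 ≤ (1 * ‖w‖) ^ 2 := by gcongr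
  have h7 : ‖q u‖ ^ 2 ≤ (1 / 2 * ‖w‖) ^ 2 := by gcongr
  linarith

/-! ### Weak solutions of `-u'' + (β s² + m) u = f` -/

/-- The Lax-Milgram theorem in a complex Hilbert space. -/
theorem surjective_of_coercive {H : Type*} [NormedAddCommGroup H] [InnerProductSpace ℂ H]
    [CompleteSpace H] (A : H →L[ℂ] H) {c : ℝ} (hc : 0 < c)
    (hA : ∀ v, c * ‖v‖ ^ 2 ≤ (⟪v, A v⟫_ℂ).re) : Function.Surjective A := by
  have hb : ∀ v, ‖v‖ ≤ (c⁻¹.toNNReal : ℝ) * ‖A v‖ := by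
    intro v
    rw [Real.coe_toNNReal _ (inv_pos.2 hc).le, ← div_eq_inv_mul, le_div_iff₀ hc]
    rcases (norm_nonneg v).eq_or_lt with h | h
    · rw [← h, zero_mul]; exact norm_nonneg _
    · have h1 := (hA v).trans ((Complex.re_le_norm _).trans (norm_inner_le_norm v (A v)))
      nlinarith
  have hcl : IsClosed (A.range : Set H) :=
    (A.antilipschitz_of_bound hb).isClosed_range A.uniformContinuous
  have := hcl.completeSpace_coe
  suffices h : A.range = ⊤ from LinearMap.range_eq_top.1 h
  -- The range is closed because $A$ is bounded below, and a vector $w$ orthogonal to it satisfies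
  -- $\langle w,Aw\rangle=0$, hence vanishes by coercivity.
  rw [← A.range.orthogonal_orthogonal, Submodule.eq_top_iff']
  intro v w hw
  have h0 : ⟪A w, w⟫_ℂ = 0 := hw _ ⟨w, rfl⟩
  have h1 := hA w
  rw [← inner_conj_symm, h0, map_zero, Complex.zero_re] at h1
  have h2 : w = 0 := by
    by_contra h
    have := norm_pos_iff.2 h
    have : 0 < c * ‖w‖ ^ 2 := by positivity
    linarith
  rw [h2, inner_zero_left]

/-- The coercivity constant of `-u'' + β s² u`. -/
def coercivity (β : ℝ) : ℝ := min 1 (2 * β / 3)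

theorem coercivity_pos {β : ℝ} (hβ : 0 < β) : 0 < coercivity β :=
  lt_min one_pos (by positivity)

/-- The two entries of the minimum in `coercivity` absorb the coefficients $1$ and $3/2$ of the
uncertainty principle. -/
theorem IsH01.coercive {Ω : Set ℝ} {u u' w : L2 Ω} (hu : IsH01 Ω u u')
    (hw : w =ᵐ[volume.restrict Ω] fun s => (s : ℂ) * u s) {β : ℝ} (hβ : 0 < β) :
    coercivity β * ‖u‖ ^ 2 ≤ ‖u'‖ ^ 2 + β * ‖w‖ ^ 2 := by
  have h1 := hu.norm_sq_le hw
  have h2 : coercivity β ≤ 1 := min_le_left _ _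
  have h3 : coercivity β ≤ 2 * β / 3 := min_le_right _ _
  have h4 := coercivity_pos hβ
  calc coercivity β * ‖u‖ ^ 2 ≤ coercivity β * (‖u'‖ ^ 2 + 3 / 2 * ‖w‖ ^ 2) := by gcongr
    _ = coercivity β * ‖u'‖ ^ 2 + coercivity β * (3 / 2 * ‖w‖ ^ 2) := by ring
    _ ≤ 1 * ‖u'‖ ^ 2 + 2 * β / 3 * (3 / 2 * ‖w‖ ^ 2) := by gcongr
    _ = _ := by ring

/-- The form space `{(u, u', s u) : u ∈ H_0^1(Ω), s u ∈ L²(Ω)}`. -/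
def formSpace (Ω : Set ℝ) : Submodule ℂ (PiLp 2 fun _ : Fin 3 => L2 Ω) where
  carrier := {x | IsH01 Ω (x 0) (x 1) ∧ x 2 =ᵐ[volume.restrict Ω] fun s => (s : ℂ) * x 0 s}
  zero_mem' := by
    refine ⟨IsH01.zero Ω, ?_⟩
    change (0 : L2 Ω) =ᵐ[volume.restrict Ω] fun s => (s : ℂ) * (0 : L2 Ω) s
    filter_upwards [Lp.coeFn_zero ℂ 2 (volume.restrict Ω)] with s hs
    rw [hs, Pi.zero_apply, mul_zero]
  add_mem' := by
    rintro x y ⟨h1, h2⟩ ⟨k1, k2⟩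
    refine ⟨h1.add k1, ?_⟩
    filter_upwards [h2, k2, Lp.coeFn_add (x 2) (y 2), Lp.coeFn_add (x 0) (y 0)] with s e1 e2 e3 e4
    rw [PiLp.add_apply, PiLp.add_apply, e3, e4, Pi.add_apply, Pi.add_apply, e1, e2, mul_add]
  smul_mem' := by
    rintro c x ⟨h1, h2⟩
    refine ⟨h1.smul c, ?_⟩
    filter_upwards [h2, Lp.coeFn_smul c (x 2), Lp.coeFn_smul c (x 0)] with s e1 e2 e3
    rw [PiLp.smul_apply, PiLp.smul_apply, e2, e3, Pi.smul_apply, Pi.smul_apply, e1, smul_eq_mul,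
      smul_eq_mul]
    ring

/-- Multiplication by $s$ is unbounded, so $w=su$ is rewritten as $w/(1+s^2)=su/(1+s^2)$, an
equality of bounded multipliers. Closedness makes the form space a Hilbert space. -/
theorem isClosed_formSpace (Ω : Set ℝ) : IsClosed (formSpace Ω : Set (PiLp 2 fun _ : Fin 3 => L2 Ω)) := by
  have hb1 : MemLp (fun s => ((1 / (1 + s ^ 2) : ℝ) : ℂ)) ∞ (volume.restrict Ω) := by
    refine memLp_top_of_continuous_of_bound Ω (m := fun s => 1 / (1 + s ^ 2)) (C := 1) ?_ ?_
    · exact continuous_const.div (by fun_prop) fun s => by positivity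
    · intro s
      rw [abs_of_nonneg (by positivity), div_le_one (by positivity)]
      nlinarith [sq_nonneg s]
  have hb2 : MemLp (fun s => ((s / (1 + s ^ 2) : ℝ) : ℂ)) ∞ (volume.restrict Ω) := by
    refine memLp_top_of_continuous_of_bound Ω (m := fun s => s / (1 + s ^ 2)) (C := 1) ?_ ?_
    · exact continuous_id.div (by fun_prop) fun s => by positivity
    · intro s
      rw [abs_div, abs_of_nonneg (show 0 ≤ 1 + s ^ 2 by positivity), div_le_one (by positivity)]
      nlinarith [sq_abs s, sq_nonneg (|s| - 1)]
  have h1 : IsClosed {x : PiLp 2 fun _ : Fin 3 => L2 Ω | IsH01 Ω (x 0) (x 1)} := by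
    simp only [isH01_iff]
    exact isClosed_closure.preimage (f := fun x : PiLp 2 fun _ : Fin 3 => L2 Ω => (x 0, x 1))
      (by fun_prop)
  have h2 : IsClosed {x : PiLp 2 fun _ : Fin 3 => L2 Ω |
      x 2 =ᵐ[volume.restrict Ω] fun s => (s : ℂ) * x 0 s} := by
    have : IsClosed {x : PiLp 2 fun _ : Fin 3 => L2 Ω | mulL2 hb1 (x 2) = mulL2 hb2 (x 0)} :=
      isClosed_eq (by fun_prop) (by fun_prop)
    convert this using 3 with x
    constructor
    · intro h
      refine Lp.ext ?_
      filter_upwards [h, mulL2_coeFn hb1 (x 2), mulL2_coeFn hb2 (x 0)] with s e1 e2 e3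
      rw [e2, e3, e1]
      push_cast
      ring
    · intro h
      have h' : mulL2 hb1 (x 2) =ᵐ[volume.restrict Ω] mulL2 hb2 (x 0) := by rw [h]
      filter_upwards [h', mulL2_coeFn hb1 (x 2), mulL2_coeFn hb2 (x 0)] with s e1 e2 e3
      rw [e2, e3] at e1
      have hs : ((1 + s ^ 2 : ℝ) : ℂ) ≠ 0 := Complex.ofReal_ne_zero.2 (by positivity)
      have : x 2 s = ((1 + s ^ 2 : ℝ) : ℂ) * (((1 / (1 + s ^ 2) : ℝ) : ℂ) * x 2 s) := by
        rw [← mul_assoc, ← Complex.ofReal_mul, mul_one_div_cancel (by positivity)]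
        simp
      rw [this, e1, ← mul_assoc, ← Complex.ofReal_mul, mul_div_cancel₀ _ (by positivity)]
  exact h1.inter h2

theorem neg_le_re_inner_mulL2 {Ω : Set ℝ} {m : ℝ → ℝ}
    (hm : MemLp (fun s => (m s : ℂ)) ∞ (volume.restrict Ω)) {η : ℝ}
    (h : ∀ᵐ s ∂(volume.restrict Ω), -η ≤ m s) (u : L2 Ω) :
    -(η * ‖u‖ ^ 2) ≤ (⟪u, mulL2 hm u⟫_ℂ).re := by
  have h1 : (⟪u, ((-η : ℝ) : ℂ) • u⟫_ℂ).re ≤ (⟪u, mulL2 hm u⟫_ℂ).re := by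
    refine re_inner_le_of_ae ?_
    filter_upwards [h, mulL2_coeFn hm u, Lp.coeFn_smul ((-η : ℝ) : ℂ) u] with s e1 e2 e3
    rw [e2, e3, Pi.smul_apply, smul_eq_mul, mul_assoc, mul_assoc, Complex.re_ofReal_mul,
      Complex.re_ofReal_mul, re_mul_conj_self]
    exact mul_le_mul_of_nonneg_right e1 (sq_nonneg _)
  rw [inner_smul_right, Complex.re_ofReal_mul, re_inner_self] at h1
  linarith

/-- Existence of weak solutions, by coercivity of the quadratic form. -/
theorem exists_weak_solution {Ω : Set ℝ} {β : ℝ} (hβ : 0 < β) {m : ℝ → ℝ}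
    (hm : MemLp (fun s => (m s : ℂ)) ∞ (volume.restrict Ω))
    (hlow : ∀ᵐ s ∂(volume.restrict Ω), -(coercivity β / 2) ≤ m s) (f : L2 Ω) :
    ∃ u u' w : L2 Ω, IsH01 Ω u u' ∧ (w =ᵐ[volume.restrict Ω] fun s => (s : ℂ) * u s) ∧
      ∀ v v' z : L2 Ω, IsH01 Ω v v' → (z =ᵐ[volume.restrict Ω] fun s => (s : ℂ) * v s) →
        ⟪v', u'⟫_ℂ + β * ⟪z, w⟫_ℂ + ⟪v, mulL2 hm u⟫_ℂ = ⟪v, f⟫_ℂ := by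
  have := (isClosed_formSpace Ω).completeSpace_coe
  let e := PiLp.continuousLinearEquiv 2 ℂ fun _ : Fin 3 => L2 Ω
  let P : Fin 3 → (PiLp 2 fun _ : Fin 3 => L2 Ω) →L[ℂ] L2 Ω := fun i =>
    (ContinuousLinearMap.proj (R := ℂ) (φ := fun _ : Fin 3 => L2 Ω) i) ∘L e.toContinuousLinearMap
  -- $D$ represents the sesquilinear form on triples $(u,u',su)$; compressing it to the form space
  -- gives the operator $A$ for Lax-Milgram.
  let D : (PiLp 2 fun _ : Fin 3 => L2 Ω) →L[ℂ] (PiLp 2 fun _ : Fin 3 => L2 Ω) :=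
    e.symm.toContinuousLinearMap ∘L
      ContinuousLinearMap.pi ![mulL2 hm ∘L P 0, P 1, (β : ℂ) • P 2]
  have hD : ∀ x y : PiLp 2 fun _ : Fin 3 => L2 Ω, ⟪x, D y⟫_ℂ =
      ⟪x 1, y 1⟫_ℂ + β * ⟪x 2, y 2⟫_ℂ + ⟪x 0, mulL2 hm (y 0)⟫_ℂ := by
    intro x y
    rw [PiLp.inner_apply, Fin.sum_univ_three]
    have e0 : D y 0 = mulL2 hm (y 0) := rfl
    have e1 : D y 1 = y 1 := rfl
    have e2 : D y 2 = (β : ℂ) • y 2 := rfl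
    rw [e0, e1, e2, inner_smul_right]
    ring
  let A : formSpace Ω →L[ℂ] formSpace Ω :=
    (formSpace Ω).orthogonalProjectionOnto ∘L D ∘L (formSpace Ω).subtypeL
  have hA : ∀ x y : formSpace Ω, ⟪x, A y⟫_ℂ = ⟪(x : PiLp 2 fun _ : Fin 3 => L2 Ω), D y⟫_ℂ :=
    fun x y => (formSpace Ω).inner_orthogonalProjectionOnto_eq_of_mem_left x (D y)
  have hκ := coercivity_pos hβ
  have hsurj : Function.Surjective A := by
    -- Three quarters of $\|u'\|^2+\beta\|su\|^2$ absorb $m\ge-\kappa/2$ and leave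
    -- $\frac\kappa4\|u\|^2$, where $\kappa$ is `coercivity β`. The last quarter controls $u'$ and
    -- $su$, since $\kappa\le1$ and $\kappa\le\beta$.
    refine surjective_of_coercive A (c := coercivity β / 4) (by positivity) fun x => ?_
    obtain ⟨x, hx1, hx2⟩ := x
    rw [hA, hD]
    simp only [Complex.add_re, Complex.re_ofReal_mul, re_inner_self, Submodule.coe_norm]
    have h1 := neg_le_re_inner_mulL2 hm hlow (x 0)
    have h2 := hx1.coercive hx2 hβ
    have h3 : coercivity β ≤ 1 := min_le_left _ _
    have h4 : coercivity β ≤ 2 * β / 3 := min_le_right _ _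
    rw [PiLp.norm_sq_eq_of_L2, Fin.sum_univ_three]
    have h5 : coercivity β * ‖x 1‖ ^ 2 ≤ 1 * ‖x 1‖ ^ 2 := by gcongr
    have h6 : coercivity β * ‖x 2‖ ^ 2 ≤ β * ‖x 2‖ ^ 2 := by gcongr; linarith
    linarith
  -- The functional $v\mapsto\langle v,f\rangle$ is represented by the projection of $(f,0,0)$ to
  -- the form space.
  obtain ⟨⟨x, hx1, hx2⟩, hx⟩ :=
    hsurj ((formSpace Ω).orthogonalProjectionOnto (e.symm ![f, 0, 0]))
  refine ⟨x 0, x 1, x 2, hx1, hx2, fun v v' z hv hz => ?_⟩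
  have hy : e.symm ![v, v', z] ∈ formSpace Ω := ⟨hv, hz⟩
  have h1 := hA ⟨_, hy⟩ ⟨x, hx1, hx2⟩
  rw [hx, hD] at h1
  refine h1.symm.trans (((formSpace Ω).inner_orthogonalProjectionOnto_eq_of_mem_left ⟨_, hy⟩ _).trans ?_)
  rw [PiLp.inner_apply, Fin.sum_univ_three]
  change ⟪v, f⟫_ℂ + ⟪v', 0⟫_ℂ + ⟪z, 0⟫_ℂ = _
  rw [inner_zero_right, inner_zero_right, add_zero, add_zero]

theorem abs_div_sqrt_one_add_le {δ : ℝ} (hδ : 0 < δ) (hδ1 : δ ≤ 1) (s : ℝ) :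
    |s / √(1 + δ * s ^ 2)| ≤ 1 / δ := by
  refine abs_le_of_sq_le_sq ?_ (by positivity)
  have hd : 0 < 1 + δ * s ^ 2 := by positivity
  rw [div_pow, Real.sq_sqrt hd.le, div_pow, one_pow, div_le_div_iff₀ hd (by positivity)]
  nlinarith [sq_nonneg s, mul_le_mul_of_nonneg_right hδ1 (mul_nonneg hδ.le (sq_nonneg s))]

theorem hasDerivAt_sq_div {δ : ℝ} (hδ : 0 < δ) (s : ℝ) :
    HasDerivAt (fun s : ℝ => s ^ 2 / (1 + δ * s ^ 2)) (2 * s / (1 + δ * s ^ 2) ^ 2) s := by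
  have hd : 1 + δ * s ^ 2 ≠ 0 := by positivity
  have h1 : HasDerivAt (fun s : ℝ => s ^ 2) (2 * s) s := by simpa using hasDerivAt_pow 2 s
  have h2 := h1.div ((h1.const_mul δ).const_add 1) hd
  have h3 : 2 * s / (1 + δ * s ^ 2) ^ 2 =
      (2 * s * (1 + δ * s ^ 2) - s ^ 2 * (δ * (2 * s))) / (1 + δ * s ^ 2) ^ 2 := by
    congr 1
    ring
  rw [h3]
  exact h2

/-- An a priori bound for `s² u`, with the weight `s²` truncated. -/
theorem norm_truncated_sq_le {Ω : Set ℝ} {β : ℝ} {u u' w f : L2 Ω}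
    (hu : IsH01 Ω u u') (hw : w =ᵐ[volume.restrict Ω] fun s => (s : ℂ) * u s)
    (heq : ∀ v v' z : L2 Ω, IsH01 Ω v v' → (z =ᵐ[volume.restrict Ω] fun s => (s : ℂ) * v s) →
        ⟪v', u'⟫_ℂ + β * ⟪z, w⟫_ℂ = ⟪v, f⟫_ℂ) {δ : ℝ} (hδ : 0 < δ) (hδ1 : δ ≤ 1)
    (hp : MemLp (fun s => ((s / √(1 + δ * s ^ 2) : ℝ) : ℂ)) ∞ (volume.restrict Ω)) :
    β * ‖mulL2 hp w‖ ^ 2 ≤ ‖mulL2 hp w‖ * ‖f‖ + ‖u‖ ^ 2 := by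
  have hd : ∀ s : ℝ, 0 < 1 + δ * s ^ 2 := fun s => by positivity
  have hd1 : ∀ s : ℝ, 1 ≤ 1 + δ * s ^ 2 := fun s => by
    have : 0 ≤ δ * s ^ 2 := by positivity
    linarith
  have hsq : ∀ s : ℝ, √(1 + δ * s ^ 2) ^ 2 = 1 + δ * s ^ 2 := fun s => Real.sq_sqrt (hd s).le
  have hsqp : ∀ s : ℝ, 0 < √(1 + δ * s ^ 2) := fun s => Real.sqrt_pos.2 (hd s)
  have hsq1 : ∀ s : ℝ, 1 ≤ √(1 + δ * s ^ 2) := fun s => Real.one_le_sqrt.2 (hd1 s)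
  have hpb := abs_div_sqrt_one_add_le hδ hδ1
  have hqb : ∀ s : ℝ, |1 / √(1 + δ * s ^ 2) ^ 3| ≤ 1 := fun s => by
    rw [abs_of_nonneg (by have := hsqp s; positivity),
      div_le_one (pow_pos (hsqp s) 3)]
    exact one_le_pow₀ (hsq1 s)
  have hgp : ∀ s : ℝ, s ^ 2 / (1 + δ * s ^ 2) = (s / √(1 + δ * s ^ 2)) * (s / √(1 + δ * s ^ 2)) :=
    fun s => by rw [← sq, div_pow, hsq]
  have hg'p : ∀ s : ℝ, 2 * s / (1 + δ * s ^ 2) ^ 2 =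
      2 * ((1 / √(1 + δ * s ^ 2) ^ 3) * (s / √(1 + δ * s ^ 2))) := fun s => by
    have h0 := (hsqp s).ne'
    have h := hsq s
    set r := √(1 + δ * s ^ 2)
    rw [← h]
    field_simp
  have hgb : ∀ s : ℝ, |s ^ 2 / (1 + δ * s ^ 2)| ≤ 1 / δ * (1 / δ) := fun s => by
    rw [hgp, abs_mul]
    exact mul_le_mul (hpb s) (hpb s) (abs_nonneg _) (by positivity)
  have hg'b : ∀ s : ℝ, |2 * s / (1 + δ * s ^ 2) ^ 2| ≤ 2 * (1 * (1 / δ)) := fun s => by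
    rw [hg'p, abs_mul, abs_mul, abs_two]
    have := mul_le_mul (hqb s) (hpb s) (abs_nonneg _) one_pos.le
    linarith
  have hg : MemLp (fun s => ((s ^ 2 / (1 + δ * s ^ 2) : ℝ) : ℂ)) ∞ (volume.restrict Ω) :=
    memLp_top_of_continuous_of_bound Ω (m := fun s => s ^ 2 / (1 + δ * s ^ 2))
      (by fun_prop (disch := intro s; exact (hd s).ne')) hgb
  have hg' : MemLp (fun s => ((2 * s / (1 + δ * s ^ 2) ^ 2 : ℝ) : ℂ)) ∞ (volume.restrict Ω) :=
    memLp_top_of_continuous_of_bound Ω (m := fun s => 2 * s / (1 + δ * s ^ 2) ^ 2)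
      (by fun_prop (disch := intro s; exact (pow_pos (hd s) 2).ne')) hg'b
  have hq : MemLp (fun s => ((1 / √(1 + δ * s ^ 2) ^ 3 : ℝ) : ℂ)) ∞ (volume.restrict Ω) :=
    memLp_top_of_continuous_of_bound Ω (m := fun s => 1 / √(1 + δ * s ^ 2) ^ 3)
      (by fun_prop (disch := intro s; exact (pow_pos (hsqp s) 3).ne')) hqb
  -- The test function is $gu$ with $g=p^2$, $p=s/\sqrt{1+\delta s^2}$. Since $g'=2qp$ with $0\le
  -- q\le1$, the term $\langle g'u,u'\rangle$ is at most $2\|u\|\|pu'\|\le\|u\|^2+\|pu'\|^2$, and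
  -- $\|pu'\|^2$ cancels against $\langle gu',u'\rangle$. With $|gu|\le|pw|$ the resulting bound has
  -- no constant depending on $\delta$.
  have hv := hu.mul (g := fun s => s ^ 2 / (1 + δ * s ^ 2))
    (g' := fun s => 2 * s / (1 + δ * s ^ 2) ^ 2)
    ((contDiff_id.pow 2).div (contDiff_const.add (contDiff_const.mul (contDiff_id.pow 2)))
      fun s => (hd s).ne') (hasDerivAt_sq_div hδ) hg hg'
  have h1 := heq _ _ (mulL2 hg w) hv (by
    filter_upwards [mulL2_coeFn hg w, mulL2_coeFn hg u, hw] with s e1 e2 e3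
    rw [e1, e2, e3]
    ring)
  have e1 : ⟪mulL2 hg u', u'⟫_ℂ = ⟪mulL2 hp u', mulL2 hp u'⟫_ℂ := by
    refine inner_congr ?_
    filter_upwards [mulL2_coeFn hg u', mulL2_coeFn hp u'] with s e1 e2
    rw [e1, e2, map_mul, map_mul, Complex.conj_ofReal, Complex.conj_ofReal, hgp]
    push_cast
    ring
  have e2 : ⟪mulL2 hg w, w⟫_ℂ = ⟪mulL2 hp w, mulL2 hp w⟫_ℂ := by
    refine inner_congr ?_
    filter_upwards [mulL2_coeFn hg w, mulL2_coeFn hp w] with s e1 e2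
    rw [e1, e2, map_mul, map_mul, Complex.conj_ofReal, Complex.conj_ofReal, hgp]
    push_cast
    ring
  have e3 : ⟪mulL2 hg' u, u'⟫_ℂ = ((2 : ℝ) : ℂ) * ⟪mulL2 hq u, mulL2 hp u'⟫_ℂ := by
    rw [← inner_smul_right]
    refine inner_congr ?_
    filter_upwards [mulL2_coeFn hg' u, mulL2_coeFn hq u, mulL2_coeFn hp u',
      Lp.coeFn_smul ((2 : ℝ) : ℂ) (mulL2 hp u')] with s e1 e2 e3 e4
    rw [e1, e2, e4, Pi.smul_apply, e3, map_mul, map_mul, Complex.conj_ofReal, Complex.conj_ofReal,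
      hg'p, smul_eq_mul]
    push_cast
    ring
  have h2 : ‖mulL2 hg u‖ ≤ 1 * ‖mulL2 hp w‖ := by
    refine norm_le_of_ae ?_
    filter_upwards [mulL2_coeFn hg u, mulL2_coeFn hp w, hw] with s e1 e2 e3
    rw [e1, e2, e3, one_mul, ← mul_assoc, norm_mul, norm_mul, ← Complex.ofReal_mul,
      Complex.norm_real, Complex.norm_real, Real.norm_eq_abs, Real.norm_eq_abs, hgp,
      abs_mul, abs_mul]
    refine mul_le_mul_of_nonneg_right (mul_le_mul_of_nonneg_left ?_ (abs_nonneg _)) (norm_nonneg _)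
    rw [abs_div, abs_of_pos (hsqp s)]
    exact div_le_self (abs_nonneg _) (hsq1 s)
  have h3 : ‖mulL2 hq u‖ ≤ 1 * ‖u‖ := norm_mulL2_le hq (.of_forall hqb) u
  have h4 := congrArg Complex.re h1
  rw [inner_add_left, e1, e2, e3] at h4
  simp only [Complex.add_re, Complex.re_ofReal_mul, re_inner_self] at h4
  have h5 := (Complex.re_le_norm _).trans (norm_inner_le_norm (𝕜 := ℂ) (mulL2 hg u) f)
  have h6 := (Complex.abs_re_le_norm _).trans
    (norm_inner_le_norm (𝕜 := ℂ) (mulL2 hq u) (mulL2 hp u'))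
  have h7 := (abs_le.1 h6).1
  have h8 : ‖mulL2 hg u‖ * ‖f‖ ≤ ‖mulL2 hp w‖ * ‖f‖ := by
    rw [one_mul] at h2; gcongr
  have h9 : ‖mulL2 hq u‖ * ‖mulL2 hp u'‖ ≤ ‖u‖ * ‖mulL2 hp u'‖ := by
    rw [one_mul] at h3; gcongr
  nlinarith [sq_nonneg (‖u‖ - ‖mulL2 hp u'‖)]

/-- Weak solutions `u` satisfy `s² u ∈ L²(Ω)`. -/
theorem exists_sq_mul {Ω : Set ℝ} {β : ℝ} (hβ : 0 < β) {u u' w f : L2 Ω}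
    (hu : IsH01 Ω u u') (hw : w =ᵐ[volume.restrict Ω] fun s => (s : ℂ) * u s)
    (heq : ∀ v v' z : L2 Ω, IsH01 Ω v v' → (z =ᵐ[volume.restrict Ω] fun s => (s : ℂ) * v s) →
        ⟪v', u'⟫_ℂ + β * ⟪z, w⟫_ℂ = ⟪v, f⟫_ℂ) :
    ∃ y : L2 Ω, y =ᵐ[volume.restrict Ω] fun s => ((s ^ 2 : ℝ) : ℂ) * u s := by
  have hδ : ∀ n : ℕ, (0 : ℝ) < 1 / ((n : ℝ) + 1) := fun n => by positivity
  have hδ1 : ∀ n : ℕ, 1 / ((n : ℝ) + 1) ≤ 1 := fun n => by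
    rw [div_le_one (by positivity)]; linarith [n.cast_nonneg (α := ℝ)]
  have hsqp : ∀ (n : ℕ) (s : ℝ), 0 < √(1 + 1 / ((n : ℝ) + 1) * s ^ 2) := fun n s => by positivity
  have hp : ∀ n : ℕ, MemLp (fun s => ((s / √(1 + 1 / ((n : ℝ) + 1) * s ^ 2) : ℝ) : ℂ)) ∞
      (volume.restrict Ω) := fun n =>
    memLp_top_of_continuous_of_bound Ω (m := fun s => s / √(1 + 1 / ((n : ℝ) + 1) * s ^ 2))
      (by fun_prop (disch := intro s; exact (hsqp n s).ne'))
      (abs_div_sqrt_one_add_le (hδ n) (hδ1 n))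
  -- With $X=\|pw\|$, the inequality $\beta X^2\le X\|f\|+\|u\|^2$ is solved for $X$ by Young's
  -- inequality.
  set C := √(‖f‖ ^ 2 / β ^ 2 + 2 * ‖u‖ ^ 2 / β) with hC
  have hbound : ∀ n, ‖mulL2 (hp n) w‖ ≤ C := fun n => by
    refine Real.le_sqrt_of_sq_le ?_
    have h := norm_truncated_sq_le hu hw heq (hδ n) (hδ1 n) (hp n)
    set X := ‖mulL2 (hp n) w‖
    rw [show ‖f‖ ^ 2 / β ^ 2 + 2 * ‖u‖ ^ 2 / β = (‖f‖ ^ 2 + 2 * ‖u‖ ^ 2 * β) / β ^ 2 by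
      field_simp, le_div_iff₀ (by positivity)]
    nlinarith [sq_nonneg (β * X - ‖f‖), mul_le_mul_of_nonneg_left h hβ.le]
  have hlim : MemLp (fun s : ℝ => (s : ℂ) * w s) 2 (volume.restrict Ω) := by
    refine ⟨(Complex.continuous_ofReal.aestronglyMeasurable).mul (Lp.aestronglyMeasurable w), ?_⟩
    have hae : ∀ᵐ s ∂(volume.restrict Ω), ∀ n, mulL2 (hp n) w s =
        ((s / √(1 + 1 / ((n : ℝ) + 1) * s ^ 2) : ℝ) : ℂ) * w s :=
      ae_all_iff.2 fun n => mulL2_coeFn (hp n) w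
    -- Fatou's lemma as the truncation parameter $1/(n+1)$ tends to $0$.
    have h1 := Lp.eLpNorm_lim_le_liminf_eLpNorm (p := 2) (μ := volume.restrict Ω)
      (f := fun n s => mulL2 (hp n) w s) (fun n => Lp.aestronglyMeasurable _)
      (fun s => (s : ℂ) * w s) (by
        filter_upwards [hae] with s hs
        simp_rw [hs]
        refine Tendsto.mul_const _ ((Complex.continuous_ofReal.tendsto s).comp ?_)
        have h0 : Tendsto (fun n : ℕ => s / √(1 + 1 / ((n : ℝ) + 1) * s ^ 2)) atTop
            (𝓝 (s / √(1 + 0 * s ^ 2))) :=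
          tendsto_const_nhds.div ((tendsto_const_nhds.add
            (tendsto_one_div_add_atTop_nhds_zero_nat.mul_const _)).sqrt) (by simp)
        simpa using h0)
    refine h1.trans_lt ((liminf_le_liminf (v := fun _ => ENNReal.ofReal C)
      (.of_forall fun n => ?_)).trans_lt ?_)
    · rw [← ENNReal.ofReal_toReal (Lp.eLpNorm_ne_top (mulL2 (hp n) w)), ← Lp.norm_def]
      exact ENNReal.ofReal_le_ofReal (hbound n)
    · rw [liminf_const]
      exact ENNReal.ofReal_lt_top
  refine ⟨hlim.toLp _, ?_⟩
  filter_upwards [hlim.coeFn_toLp, hw] with s h1 h2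
  rw [h1, h2]
  push_cast
  ring

/-- Once $s^2u\in L^2$, the form equation tested with $\varphi\in C_c^\infty$ says that $Vu-f$ is
the weak second derivative, so the weak solution lies in the operator domain. -/
theorem exists_mem_schrodingerGraph {Ω : Set ℝ} {β : ℝ} (hβ : 0 < β) {m V : ℝ → ℝ}
    (hm : MemLp (fun s => (m s : ℂ)) ∞ (volume.restrict Ω))
    (hlow : ∀ᵐ s ∂(volume.restrict Ω), -(coercivity β / 2) ≤ m s)
    (hV : ∀ᵐ s ∂(volume.restrict Ω), V s = β * s ^ 2 + m s) (f : L2 Ω) :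
    ∃ u, (u, f) ∈ schrodingerGraph Ω V := by
  obtain ⟨u, u', w, hu, hw, heq⟩ := exists_weak_solution hβ hm hlow f
  -- The bounded part $mu$ is moved to the right-hand side, leaving the pure quadratic potential.
  obtain ⟨y, hy⟩ := exists_sq_mul (f := f - mulL2 hm u) hβ hu hw (fun v v' z hv hz => by
    rw [inner_sub_right, ← heq v v' z hv hz]; ring)
  refine ⟨u, u', (β : ℂ) • y + mulL2 hm u - f, (β : ℂ) • y + mulL2 hm u, ⟨hu.1, ?_⟩, hu, ?_,
    by simp⟩
  · rw [isWeakDeriv_iff]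
    rintro ⟨p, q⟩ hpq
    have hH : IsH01 Ω p q := isH01_iff.2 (subset_closure hpq)
    obtain ⟨φ, hφ, h1, h2⟩ := hpq
    have hz : MemLp (fun s : ℝ => (s : ℂ) * φ s) 2 (volume.restrict Ω) :=
      (Complex.continuous_ofReal.mul hφ.1.continuous).memLp_of_hasCompactSupport hφ.2.1.mul_left
    have h3 := heq p q (hz.toLp _) hH (by
      filter_upwards [hz.coeFn_toLp, h1] with s e1 e2
      rw [e1, e2])
    have h4 : ⟪hz.toLp _, w⟫_ℂ = ⟪p, y⟫_ℂ := by
      refine inner_congr ?_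
      filter_upwards [hz.coeFn_toLp, h1, hw, hy] with s e1 e2 e3 e4
      rw [e1, e2, e3, e4, map_mul, Complex.conj_ofReal]
      push_cast
      ring
    rw [h4] at h3
    simp only [inner_sub_right, inner_add_right, inner_smul_right, ← h3]
    ring
  · filter_upwards [hV, hy, mulL2_coeFn hm u, Lp.coeFn_add ((β : ℂ) • y) (mulL2 hm u),
      Lp.coeFn_smul (β : ℂ) y] with s e1 e2 e3 e4 e5
    rw [e4, Pi.add_apply, e5, Pi.smul_apply, e2, e3, e1, smul_eq_mul]
    push_cast
    ring

/-- A bound for the resolvent of `-u'' + β s² u + m u` in terms of `β`. -/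
def resolventBound (β : ℝ) : ℝ :=
  2 / coercivity β + √(4 / coercivity β) + √(4 / coercivity β / β)

theorem resolventBound_pos {β : ℝ} (hβ : 0 < β) : 0 < resolventBound β := by
  have := coercivity_pos hβ
  unfold resolventBound
  positivity

/-- `u` is a solution of `-u'' + V u = f` in the sense of quadratic forms, with `u'` the weak
derivative, `Vu = V u` and `w = s u`, and with the bound `K` for the solution operator. -/
structure IsFormSolution (Ω : Set ℝ) (V : ℝ → ℝ) (K : ℝ) (f u u' Vu w : L2 Ω) : Prop where
  h01 : IsH01 Ω u u'
  potential : Vu =ᵐ[volume.restrict Ω] fun s => (V s : ℂ) * u s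
  position : w =ᵐ[volume.restrict Ω] fun s => (s : ℂ) * u s
  form : ∀ v v' : L2 Ω, IsH01 Ω v v' → ⟪v', u'⟫_ℂ + ⟪v, Vu⟫_ℂ = ⟪v, f⟫_ℂ
  norm_le : ‖u‖ ≤ K * ‖f‖
  norm_deriv_le : ‖u'‖ ≤ K * ‖f‖
  norm_position_le : ‖w‖ ≤ K * ‖f‖

theorem le_of_sq_le_mul {x c y : ℝ} (hy : 0 ≤ y) (h : x ^ 2 ≤ c * y ^ 2) : x ≤ √c * y := by
  have h1 := Real.le_sqrt_of_sq_le h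
  rwa [Real.sqrt_mul' _ (sq_nonneg y), Real.sqrt_sq hy] at h1

/-- Testing with $u$ itself gives the energy estimate. The constant sees neither $\Omega$ nor the
size of $m$, only its lower bound; this is what makes it uniform in $\varepsilon$ later. -/
theorem exists_isFormSolution {Ω : Set ℝ} {β : ℝ} (hβ : 0 < β) {m V : ℝ → ℝ}
    (hm : MemLp (fun s => (m s : ℂ)) ∞ (volume.restrict Ω))
    (hlow : ∀ᵐ s ∂(volume.restrict Ω), -(coercivity β / 2) ≤ m s)
    (hV : ∀ᵐ s ∂(volume.restrict Ω), V s = β * s ^ 2 + m s) {u f : L2 Ω}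
    (huf : (u, f) ∈ schrodingerGraph Ω V) :
    ∃ u' Vu w, IsFormSolution Ω V (resolventBound β) f u u' Vu w := by
  obtain ⟨u', u'', Vu, h2, h01, hVu, hf⟩ := huf
  simp only at h2 h01 hVu hf
  have hform : ∀ v v' : L2 Ω, IsH01 Ω v v' → ⟪v', u'⟫_ℂ + ⟪v, Vu⟫_ℂ = ⟪v, f⟫_ℂ := by
    intro v v' hv
    rw [inner_of_isWeakDeriv h2.2 hv, hf, inner_add_right, inner_neg_right]
  have hκ := coercivity_pos hβ
  -- Membership of $Vu$ and $mu$ in $L^2$ puts $s^2u$ in $L^2$, and then $su$ as well because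
  -- $|s|\le1+s^2$.
  let y : L2 Ω := (β⁻¹ : ℂ) • (Vu - mulL2 hm u)
  have hy : y =ᵐ[volume.restrict Ω] fun s => ((s ^ 2 : ℝ) : ℂ) * u s := by
    filter_upwards [hV, hVu, mulL2_coeFn hm u, Lp.coeFn_sub Vu (mulL2 hm u),
      Lp.coeFn_smul (β⁻¹ : ℂ) (Vu - mulL2 hm u)] with s e1 e2 e3 e4 e5
    rw [e5, Pi.smul_apply, e4, Pi.sub_apply, e2, e3, e1, smul_eq_mul]
    have : (β : ℂ) ≠ 0 := Complex.ofReal_ne_zero.2 hβ.ne'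
    push_cast
    field_simp
    ring
  have hw : MemLp (fun s : ℝ => (s : ℂ) * u s) 2 (volume.restrict Ω) := by
    refine ((Lp.memLp u).norm.add (Lp.memLp y).norm).of_le
      (Complex.continuous_ofReal.aestronglyMeasurable.mul (Lp.aestronglyMeasurable u)) ?_
    filter_upwards [hy] with s e1
    rw [Pi.add_apply, e1, norm_mul, norm_mul, Complex.norm_real, Complex.norm_real,
      Real.norm_of_nonneg (sq_nonneg s), Real.norm_eq_abs, Real.norm_of_nonneg (by positivity)]
    nlinarith [norm_nonneg (u s), sq_abs s,
      mul_nonneg (sq_nonneg (|s| - 1 / 2)) (norm_nonneg (u s))]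
  have hwe := hw.coeFn_toLp
  set w := hw.toLp _ with hwdef
  have hVuw : ⟪u, Vu⟫_ℂ = (β : ℂ) * ⟪w, w⟫_ℂ + ⟪u, mulL2 hm u⟫_ℂ := by
    have h1 : Vu = (β : ℂ) • y + mulL2 hm u := by
      simp only [y, smul_smul]
      rw [mul_inv_cancel₀ (Complex.ofReal_ne_zero.2 hβ.ne'), one_smul, sub_add_cancel]
    have h3 : ⟪u, y⟫_ℂ = ⟪w, w⟫_ℂ := by
      refine inner_congr ?_
      filter_upwards [hy, hwe] with s e1 e2
      rw [e1, e2, map_mul, Complex.conj_ofReal]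
      push_cast
      ring
    rw [h1, inner_add_right, inner_smul_right, h3]
  have h3 := congrArg Complex.re (hform u u' h01)
  rw [hVuw] at h3
  simp only [Complex.add_re, Complex.re_ofReal_mul, re_inner_self] at h3
  have h4 := neg_le_re_inner_mulL2 hm hlow u
  have h5 := h01.coercive hwe hβ
  have h6 := (Complex.re_le_norm _).trans (norm_inner_le_norm (𝕜 := ℂ) u f)
  -- Half of the coercivity is spent on $m$; the other half yields $\|u\|\le\frac2\kappa\|f\|$, and
  -- reinserting this bounds the form by $\frac4\kappa\|f\|^2$.
  have h7 : coercivity β * ‖u‖ ^ 2 ≤ 2 * (‖u‖ * ‖f‖) := by linarith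
  have h8 : ‖u‖ ≤ 2 / coercivity β * ‖f‖ := by
    rw [div_mul_eq_mul_div, le_div_iff₀ hκ]
    rcases (norm_nonneg u).eq_or_lt with h | h
    · rw [← h, zero_mul]; positivity
    · nlinarith
  have h9 : ‖u'‖ ^ 2 + β * ‖w‖ ^ 2 ≤ 4 / coercivity β * ‖f‖ ^ 2 := by
    have : ‖u‖ * ‖f‖ ≤ 2 / coercivity β * ‖f‖ * ‖f‖ := by gcongr
    have e : 4 / coercivity β * ‖f‖ ^ 2 = 2 * (2 / coercivity β * ‖f‖ * ‖f‖) := by ring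
    linarith
  have h10 : 0 ≤ β * ‖w‖ ^ 2 := by positivity
  have h11 : ‖u'‖ ≤ √(4 / coercivity β) * ‖f‖ :=
    le_of_sq_le_mul (norm_nonneg _) (by linarith)
  have h12 : ‖w‖ ≤ √(4 / coercivity β / β) * ‖f‖ := by
    refine le_of_sq_le_mul (norm_nonneg _) ?_
    rw [div_mul_eq_mul_div, le_div_iff₀ hβ]
    nlinarith [sq_nonneg ‖u'‖]
  have p1 : 0 ≤ 2 / coercivity β * ‖f‖ := by positivity
  have p2 : 0 ≤ √(4 / coercivity β) * ‖f‖ := by positivity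
  have p3 : 0 ≤ √(4 / coercivity β / β) * ‖f‖ := by positivity
  refine ⟨u', Vu, w, h01, hVu, hwe, hform, ?_, ?_, ?_⟩ <;>
  · rw [resolventBound, add_mul, add_mul]
    linarith

/-! ### Bounded inverses read off from graphs -/

theorem isBoundedInverse_iff {H : Type*} [NormedAddCommGroup H] [NormedSpace ℂ H]
    {A : H →ₗ.[ℂ] H} {R : H →L[ℂ] H} :
    IsBoundedInverse A R ↔ (∀ f, (R f, f) ∈ A.graph) ∧ ∀ u f, (u, f) ∈ A.graph → R f = u := by
  simp only [IsBoundedInverse, LinearPMap.mem_graph_iff]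
  refine and_congr (forall_congr' fun f => ?_) ?_
  · constructor
    · rintro ⟨h1, h2⟩
      exact ⟨⟨R f, h1⟩, rfl, h2⟩
    · rintro ⟨⟨y, hy⟩, h1, h2⟩
      simp only at h1
      subst h1
      exact ⟨hy, h2⟩
  · constructor
    · rintro h u f ⟨y, rfl, rfl⟩
      exact h y
    · intro h u
      exact h u (A u) ⟨u, rfl, rfl⟩

/-- A bijective graph with a bounded inverse is the graph of the inverse of a bounded operator. -/
theorem exists_isBoundedInverse {H : Type*} [NormedAddCommGroup H] [NormedSpace ℂ H]
    {A : H →ₗ.[ℂ] H} {K : ℝ} (hsurj : ∀ f, ∃ u, (u, f) ∈ A.graph)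
    (hb : ∀ u f, (u, f) ∈ A.graph → ‖u‖ ≤ K * ‖f‖) :
    ∃ R : H →L[ℂ] H, IsBoundedInverse A R := by
  have huniq : ∀ u v f, (u, f) ∈ A.graph → (v, f) ∈ A.graph → u = v := by
    intro u v f hu hv
    have h := hb _ _ (A.graph.sub_mem hu hv)
    rw [sub_self, norm_zero, mul_zero] at h
    exact sub_eq_zero.1 (norm_le_zero_iff.1 h)
  choose R hR using hsurj
  refine ⟨LinearMap.mkContinuous ⟨⟨R, fun f g => ?_⟩, fun c f => ?_⟩ K fun f => hb _ _ (hR f),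
    isBoundedInverse_iff.2 ⟨hR, fun u f hu => huniq _ _ _ (hR f) hu⟩⟩
  · exact huniq _ _ _ (hR _) (A.graph.add_mem (hR f) (hR g))
  · exact huniq _ _ _ (hR _) (A.graph.smul_mem c (hR f))

/-- The operator `-u'' + V u` with `V = β s² + m`, `m` bounded and bounded below by a small
negative constant, has a bounded inverse. -/
theorem exists_schrodinger_inverse {Ω : Set ℝ} (hΩ : IsOpen Ω) {β : ℝ} (hβ : 0 < β)
    {m V : ℝ → ℝ} (hm : MemLp (fun s => (m s : ℂ)) ∞ (volume.restrict Ω))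
    (hlow : ∀ᵐ s ∂(volume.restrict Ω), -(coercivity β / 2) ≤ m s)
    (hV : ∀ᵐ s ∂(volume.restrict Ω), V s = β * s ^ 2 + m s) :
    ∃ R : L2 Ω →L[ℂ] L2 Ω, IsBoundedInverse (schrodinger Ω V) R ∧
      ∀ f, ∃ u' Vu w, IsFormSolution Ω V (resolventBound β) f (R f) u' Vu w := by
  have hg := schrodinger_graph hΩ V
  obtain ⟨R, hR⟩ := exists_isBoundedInverse (A := schrodinger Ω V) (K := resolventBound β)
    (fun f => hg ▸ exists_mem_schrodingerGraph hβ hm hlow hV f) (fun u f huf => by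
      rw [hg] at huf
      obtain ⟨u', Vu, w, h⟩ := exists_isFormSolution hβ hm hlow hV huf
      exact h.norm_le)
  refine ⟨R, hR, fun f => exists_isFormSolution hβ hm hlow hV ?_⟩
  rw [← hg]
  exact (isBoundedInverse_iff.1 hR).1 f

/-- Symmetry of the solution operator: the form is Hermitian because $V$ is real. -/
theorem IsFormSolution.inner_symm {Ω : Set ℝ} {V : ℝ → ℝ} {K K' : ℝ}
    {f u u' Vu w g v v' Vv z : L2 Ω} (hu : IsFormSolution Ω V K f u u' Vu w)
    (hv : IsFormSolution Ω V K' g v v' Vv z) : ⟪g, u⟫_ℂ = ⟪v, f⟫_ℂ := by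
  have h1 := hu.form v v' hv.h01
  have h2 := congrArg conj (hv.form u u' hu.h01)
  rw [map_add, inner_conj_symm, inner_conj_symm, inner_conj_symm] at h2
  rw [← h1, ← h2]
  congr 1
  refine inner_congr ?_
  filter_upwards [hu.potential, hv.potential] with s e1 e2
  rw [e1, e2, map_mul, Complex.conj_ofReal]
  ring

/-! ### Comparison of solutions on `Ω` and on `ℝ` -/

theorem restrictL2_coeFn (Ω : Set ℝ) (f : L2 univ) :
    restrictL2 Ω f =ᵐ[volume.restrict Ω] f :=
  (memLp_restrict Ω f).coeFn_toLp

theorem extendL2_coeFn {Ω : Set ℝ} (hΩ : MeasurableSet Ω) (f : L2 Ω) :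
    extendL2 hΩ f =ᵐ[volume.restrict univ] Ω.indicator f :=
  (memLp_extend hΩ f).coeFn_toLp

theorem inner_extendL2 {Ω : Set ℝ} (hΩ : MeasurableSet Ω) (w : L2 Ω) (f : L2 univ) :
    ⟪extendL2 hΩ w, f⟫_ℂ = ⟪w, restrictL2 Ω f⟫_ℂ := by
  rw [inner_eq_integral (extendL2_coeFn hΩ w) (ae_eq_refl _),
    inner_eq_integral (ae_eq_refl _) (restrictL2_coeFn Ω f), setIntegral_univ,
    ← integral_indicator hΩ]
  congr 1
  ext s
  by_cases hs : s ∈ Ω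
  · rw [indicator_of_mem hs, indicator_of_mem hs]
  · rw [indicator_of_notMem hs, indicator_of_notMem hs, map_zero, mul_zero]

theorem norm_extendL2 {Ω : Set ℝ} (hΩ : MeasurableSet Ω) (f : L2 Ω) :
    ‖extendL2 hΩ f‖ = ‖f‖ := by
  change ‖(memLp_extend hΩ f).toLp (Ω.indicator f)‖ = ‖f‖
  rw [Lp.norm_toLp, Lp.norm_def, Measure.restrict_univ, eLpNorm_indicator_eq_eLpNorm_restrict hΩ]

theorem norm_restrictL2_le (Ω : Set ℝ) (f : L2 univ) : ‖restrictL2 Ω f‖ ≤ ‖f‖ := by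
  change ‖(memLp_restrict Ω f).toLp f‖ ≤ ‖f‖
  rw [Lp.norm_toLp, Lp.norm_def]
  exact ENNReal.toReal_mono (Lp.eLpNorm_ne_top f)
    (eLpNorm_mono_measure _ (Measure.restrict_mono (subset_univ Ω) le_rfl))

/-- The Dirichlet condition enters here: a test function on $\Omega$ is its own extension by zero,
and $H_0^1$ follows by density. -/
theorem IsH01.extend {Ω : Set ℝ} (hΩ : MeasurableSet Ω) {u u' : L2 Ω} (hu : IsH01 Ω u u') :
    IsH01 univ (extendL2 hΩ u) (extendL2 hΩ u') := by
  rw [isH01_iff] at hu ⊢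
  refine map_mem_closure (f := fun p : L2 Ω × L2 Ω => (extendL2 hΩ p.1, extendL2 hΩ p.2))
    (by fun_prop) hu ?_
  rintro ⟨p, q⟩ ⟨φ, hφ, h1, h2⟩
  refine ⟨φ, hφ.mono (subset_univ _), ?_, ?_⟩
  · refine (extendL2_coeFn hΩ p).trans ((ae_indicator hΩ h1).trans (.of_forall fun s => ?_))
    exact indicator_apply_eq_self.2 fun hs => hφ.eq_zero hs
  · refine (extendL2_coeFn hΩ q).trans ((ae_indicator hΩ h2).trans (.of_forall fun s => ?_))
    exact indicator_apply_eq_self.2 fun hs => hφ.deriv_eq_zero hs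

/-- Localization of an element of `H^1(ℝ)` by a cutoff supported in `Ω`. -/
theorem IsH01.restrict_mul {Ω : Set ℝ} {u u' : L2 univ} (hu : IsH01 univ u u') {g g' : ℝ → ℝ}
    (hg : ContDiff ℝ ∞ g) (hg' : ∀ s, HasDerivAt g (g' s) s) (hsupp : tsupport g ⊆ Ω)
    (hb : MemLp (fun s => (g s : ℂ)) ∞ (volume.restrict univ))
    (hb' : MemLp (fun s => (g' s : ℂ)) ∞ (volume.restrict univ)) :
    IsH01 Ω (restrictL2 Ω (mulL2 hb u)) (restrictL2 Ω (mulL2 hb' u + mulL2 hb u')) := by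
  rw [isH01_iff] at hu ⊢
  let Φ : L2 univ × L2 univ →L[ℂ] L2 Ω × L2 Ω :=
    (restrictL2 Ω ∘L mulL2 hb ∘L ContinuousLinearMap.fst ℂ _ _).prod
      (restrictL2 Ω ∘L (mulL2 hb' ∘L ContinuousLinearMap.fst ℂ _ _ +
        mulL2 hb ∘L ContinuousLinearMap.snd ℂ _ _))
  change Φ (u, u') ∈ _
  refine map_mem_closure Φ.continuous hu ?_
  rintro ⟨p, q⟩ ⟨φ, hφ, h1, h2⟩
  refine ⟨fun s => (g s : ℂ) * φ s, ⟨(hφ.mul_ofReal hg).1, (hφ.mul_ofReal hg).2.1, ?_⟩, ?_, ?_⟩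
  · exact (tsupport_mul_subset_left (f := fun s => (g s : ℂ)) (g := φ)).trans
      ((tsupport_comp_subset (g := fun x : ℝ => (x : ℂ)) (by simp) g).trans hsupp)
  · refine (restrictL2_coeFn Ω (mulL2 hb p)).trans (ae_restrict_of_univ Ω ?_)
    filter_upwards [mulL2_coeFn hb p, h1] with s e1 e2
    rw [e1, ← e2]
  · refine (restrictL2_coeFn Ω (mulL2 hb' p + mulL2 hb q)).trans (ae_restrict_of_univ Ω ?_)
    filter_upwards [mulL2_coeFn hb' p, mulL2_coeFn hb q, h1, h2,
      Lp.coeFn_add (mulL2 hb' p) (mulL2 hb q)] with s e1 e2 e3 e4 e5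
    rw [deriv_ofReal_mul (hg' s) (hφ.hasDerivAt s), ← e4, ← e3, e5, Pi.add_apply, e1, e2]

theorem norm_inner_le_of_le {H : Type*} [NormedAddCommGroup H] [InnerProductSpace ℂ H] {x y : H}
    {a b : ℝ} (hx : ‖x‖ ≤ a) (hy : ‖y‖ ≤ b) : ‖⟪x, y⟫_ℂ‖ ≤ a * b :=
  (norm_inner_le_norm x y).trans
    (mul_le_mul hx hy (norm_nonneg _) ((norm_nonneg _).trans hx))

/-- Removing a cutoff costs `1 / L`. -/
theorem norm_sub_mulL2_le {Ω : Set ℝ} {χ : ℝ → ℝ}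
    (hb : MemLp (fun s => (χ s : ℂ)) ∞ (volume.restrict Ω)) {L : ℝ}
    (hχ : ∀ s, |1 - χ s| ≤ 1 / L * |s|) {u y : L2 Ω}
    (hy : y =ᵐ[volume.restrict Ω] fun s => (s : ℂ) * u s) :
    ‖u - mulL2 hb u‖ ≤ 1 / L * ‖y‖ := by
  refine norm_le_of_ae ?_
  filter_upwards [hy, mulL2_coeFn hb u, Lp.coeFn_sub u (mulL2 hb u)] with s e1 e2 e3
  rw [e3, Pi.sub_apply, e2, e1, norm_mul, Complex.norm_real, ← mul_assoc,
    show u s - (χ s : ℂ) * u s = ((1 - χ s : ℝ) : ℂ) * u s by push_cast; ring, norm_mul,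
    Complex.norm_real]
  exact mul_le_mul_of_nonneg_right (hχ s) (norm_nonneg _)

/-- Quantitative comparison of `-u'' + V u = f` on `ℝ` and `-w'' + V' w = g` on `Ω`, through a
cutoff `χ` on whose support the potentials are close. -/
theorem norm_inner_sub_le {Ω : Set ℝ} (hΩ : MeasurableSet Ω) {V V' : ℝ → ℝ} {K K' : ℝ}
    (hK' : 0 ≤ K')
    {f u u' Vu y g : L2 univ} {w w' Vw z : L2 Ω} (hu : IsFormSolution univ V K f u u' Vu y)
    (hw : IsFormSolution Ω V' K' (restrictL2 Ω g) w w' Vw z)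
    {χ χ' : ℝ → ℝ} (hχ : ContDiff ℝ ∞ χ) (hχ' : ∀ s, HasDerivAt χ (χ' s) s)
    (hsupp : tsupport χ ⊆ Ω) (hχb : ∀ s, |χ s| ≤ 1) {D L θ : ℝ} (hθ : 0 ≤ θ) (hχ'b : ∀ s, |χ' s| ≤ D)
    (hL : 0 < L) (hχL : ∀ s, |1 - χ s| ≤ 1 / L * |s|)
    (hVm : AEStronglyMeasurable (fun s => V s - V' s) (volume.restrict Ω))
    (hVV : ∀ᵐ s ∂(volume.restrict Ω), |χ s * (V s - V' s)| ≤ θ) :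
    ‖⟪w, restrictL2 Ω f⟫_ℂ - ⟪g, u⟫_ℂ‖ ≤
      ((K + K') / L + 2 * D * K * K' + θ * K * K') * (‖f‖ * ‖g‖) := by
  have hχ'c : Continuous χ' := by
    have h : χ' = deriv χ := funext fun s => (hχ' s).deriv.symm
    rw [h]
    exact hχ.continuous_deriv (by simp)
  have hb := memLp_top_of_continuous_of_bound univ hχ.continuous hχb
  have hb' := memLp_top_of_continuous_of_bound univ hχ'c hχ'b
  have hρ : MemLp (fun s => ((χ s * (V s - V' s) : ℝ) : ℂ)) ∞ (volume.restrict Ω) :=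
    memLp_top_of_bound (Complex.continuous_ofReal.comp_aestronglyMeasurable
      (hχ.continuous.aestronglyMeasurable.mul hVm)) θ
      (by filter_upwards [hVV] with s hs; rwa [Complex.norm_real])
  set W := extendL2 hΩ w with hW
  set W' := extendL2 hΩ w' with hW'
  -- Each equation is tested with the cut-off solution of the other: $\chi W$ on the line, where $W$
  -- extends $w$ by zero, and $\chi u$ in $\Omega$.
  have f1 := hu.form _ _ ((hw.h01.extend hΩ).mul hχ hχ' hb hb')
  have f2 := congrArg conj (hw.form _ _ (hu.h01.restrict_mul hχ hχ' hsupp hb hb'))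
  rw [map_add, inner_conj_symm, inner_conj_symm, inner_conj_symm, ← inner_extendL2 hΩ,
    inner_add_right] at f2
  rw [← hW, ← hW', inner_add_left] at f1
  rw [← hW'] at f2
  have e1 : ⟪mulL2 hb W', u'⟫_ℂ = ⟪W', mulL2 hb u'⟫_ℂ := inner_mulL2 _ _ _
  have e2 : ⟪restrictL2 Ω g, restrictL2 Ω (mulL2 hb u)⟫_ℂ = ⟪g, mulL2 hb u⟫_ℂ := by
    rw [← inner_extendL2 hΩ]
    refine inner_congr ?_
    have h := ae_indicator hΩ (restrictL2_coeFn Ω g)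
    filter_upwards [extendL2_coeFn hΩ (restrictL2 Ω g), h, mulL2_coeFn hb u] with s a1 a2 a3
    rw [a1, a2, a3]
    by_cases hs : s ∈ Ω
    · rw [indicator_of_mem hs]
    · rw [image_eq_zero_of_notMem_tsupport fun h => hs (hsupp h)]
      simp
  -- Neither potential is assumed bounded; only the product $\chi(V-V')$ is used as a multiplier.
  have e3 : ⟪mulL2 hb W, Vu⟫_ℂ - ⟪Vw, restrictL2 Ω (mulL2 hb u)⟫_ℂ
      = ⟪w, mulL2 hρ (restrictL2 Ω u)⟫_ℂ := by
    rw [inner_mulL2, hW, inner_extendL2, sub_eq_iff_eq_add]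
    have : ⟪Vw, restrictL2 Ω (mulL2 hb u)⟫_ℂ
        = ⟪w, restrictL2 Ω (mulL2 hb Vu) - mulL2 hρ (restrictL2 Ω u)⟫_ℂ := by
      refine inner_congr ?_
      filter_upwards [restrictL2_coeFn Ω (mulL2 hb u), restrictL2_coeFn Ω (mulL2 hb Vu),
        ae_restrict_of_univ Ω (mulL2_coeFn hb u), ae_restrict_of_univ Ω (mulL2_coeFn hb Vu),
        ae_restrict_of_univ Ω hu.potential, restrictL2_coeFn Ω u,
        mulL2_coeFn hρ (restrictL2 Ω u), hw.potential,
        Lp.coeFn_sub (restrictL2 Ω (mulL2 hb Vu)) (mulL2 hρ (restrictL2 Ω u))]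
        with s a1 a2 a3 a4 a5 a6 a7 a8 a9
      rw [a1, a3, a8, a9, Pi.sub_apply, a2, a4, a5, a7, a6, map_mul, Complex.conj_ofReal]
      push_cast
      ring
    rw [this, inner_sub_right]
    ring
  -- The terms $\langle W',\chi u'\rangle$ cancel. What remains are the tails outside the cutoff,
  -- the two commutators with $\chi'$, and the difference of the potentials.
  have key : ⟪w, restrictL2 Ω f⟫_ℂ - ⟪g, u⟫_ℂ =
      ⟪W - mulL2 hb W, f⟫_ℂ - ⟪g, u - mulL2 hb u⟫_ℂ + ⟪mulL2 hb' W, u'⟫_ℂ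
        - ⟪W', mulL2 hb' u⟫_ℂ + ⟪w, mulL2 hρ (restrictL2 Ω u)⟫_ℂ := by
    rw [← inner_extendL2 hΩ, ← hW, inner_sub_left, inner_sub_right, ← e3, ← f1, ← e2, ← f2, e1]
    ring
  have hF := norm_nonneg f
  have hG := norm_nonneg g
  have hD : 0 ≤ D := (abs_nonneg _).trans (hχ'b 0)
  have hRg := norm_restrictL2_le Ω g
  have b1 : ‖W‖ ≤ K' * ‖g‖ := by
    rw [hW, norm_extendL2]
    exact hw.norm_le.trans (by gcongr)
  have b2 : ‖W'‖ ≤ K' * ‖g‖ := by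
    rw [hW', norm_extendL2]
    exact hw.norm_deriv_le.trans (by gcongr)
  have b3 : ‖W - mulL2 hb W‖ ≤ 1 / L * (K' * ‖g‖) := by
    have hz : extendL2 hΩ z =ᵐ[volume.restrict univ] fun s => (s : ℂ) * W s := by
      filter_upwards [extendL2_coeFn hΩ z, extendL2_coeFn hΩ w, ae_indicator hΩ hw.position]
        with s a1 a2 a3
      rw [a1, a3, hW, a2]
      by_cases hs : s ∈ Ω
      · rw [indicator_of_mem hs, indicator_of_mem hs]
      · rw [indicator_of_notMem hs, indicator_of_notMem hs, mul_zero]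
    refine (norm_sub_mulL2_le hb hχL hz).trans ?_
    rw [norm_extendL2]
    have := hw.norm_position_le.trans (mul_le_mul_of_nonneg_left hRg hK')
    gcongr
  have b4 : ‖u - mulL2 hb u‖ ≤ 1 / L * (K * ‖f‖) := by
    refine (norm_sub_mulL2_le hb hχL hu.position).trans ?_
    have := hu.norm_position_le
    gcongr
  have b5 : ‖mulL2 hb' W‖ ≤ D * (K' * ‖g‖) :=
    (norm_mulL2_le hb' (.of_forall hχ'b) W).trans (by gcongr)
  have b6 : ‖mulL2 hb' u‖ ≤ D * (K * ‖f‖) :=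
    (norm_mulL2_le hb' (.of_forall hχ'b) u).trans (by gcongr; exact hu.norm_le)
  have b7 : ‖⟪w, mulL2 hρ (restrictL2 Ω u)⟫_ℂ‖ ≤ θ * (K * ‖f‖) * (K' * ‖g‖) := by
    refine (norm_inner_le_norm _ _).trans ?_
    have h1 := norm_mulL2_le hρ hVV (restrictL2 Ω u)
    have h2 : ‖restrictL2 Ω u‖ ≤ K * ‖f‖ := (norm_restrictL2_le Ω u).trans hu.norm_le
    have h3 : ‖w‖ ≤ K' * ‖g‖ := hw.norm_le.trans (by gcongr)
    calc ‖w‖ * ‖mulL2 hρ (restrictL2 Ω u)‖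
        ≤ (K' * ‖g‖) * (θ * (K * ‖f‖)) := by
          gcongr
          exact h1.trans (by gcongr)
      _ = _ := by ring
  rw [key]
  have c1 := norm_inner_le_of_le b3 (le_refl ‖f‖)
  have c2 := norm_inner_le_of_le (le_refl ‖g‖) b4
  have c3 := norm_inner_le_of_le b5 hu.norm_deriv_le
  have c4 := norm_inner_le_of_le b2 b6
  refine (norm_add_le_of_le (norm_sub_le_of_le (norm_add_le_of_le (norm_sub_le_of_le c1 c2) c3) c4)
    b7).trans (le_of_eq ?_)
  ring

/-! ### Dilations of Schrödinger operators -/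

theorem ae_dilate {A B : Set ℝ} {c : ℝ} (hc : 0 < c) (hB : (fun s => c * s) ⁻¹' A = B)
    {p : ℝ → Prop} (h : ∀ᵐ t ∂(volume.restrict A), p t) :
    ∀ᵐ s ∂(volume.restrict B), p (c * s) := by
  have hq := (Homeomorph.mulLeft₀ c hc.ne').measurableEmbedding.measurable
  refine ae_of_ae_map (f := fun s => c * s) (p := p) hq.aemeasurable ?_
  rw [map_mul_restrict hc hB]
  exact Measure.ae_smul_measure h _

theorem IsTest.dilate {A B : Set ℝ} {c : ℝ} (hc : 0 < c) (hB : (fun s => c * s) ⁻¹' A = B)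
    {φ : ℝ → ℂ} (hφ : IsTest A φ) : IsTest B (fun s => ((√c : ℝ) : ℂ) * φ (c * s)) := by
  refine IsTest.smul _ ⟨hφ.1.comp (contDiff_const.mul contDiff_id),
    hφ.2.1.comp_homeomorph (Homeomorph.mulLeft₀ c hc.ne'), ?_⟩
  refine (tsupport_comp_subset_preimage φ (f := fun s => c * s) (by fun_prop)).trans ?_
  rw [← hB]
  exact preimage_mono hφ.2.2

theorem dilate_mem_testPairs {A B : Set ℝ} {c : ℝ} (hc : 0 < c)
    (hB : (fun s => c * s) ⁻¹' A = B) {p : L2 A × L2 A} (hp : p ∈ testPairs A) :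
    (dilate hc hB p.1, (c : ℂ) • dilate hc hB p.2) ∈ testPairs B := by
  obtain ⟨φ, hφ, h1, h2⟩ := hp
  refine ⟨_, hφ.dilate hc hB, ?_, ?_⟩
  · filter_upwards [dilate_coeFn hc hB p.1, ae_dilate hc hB h1] with s e1 e2
    rw [e1, e2]
  · filter_upwards [dilate_coeFn hc hB p.2, ae_dilate hc hB h2,
      Lp.coeFn_smul (c : ℂ) (dilate hc hB p.2)] with s e1 e2 e3
    have h := ((hφ.hasDerivAt (c * s)).scomp s ((hasDerivAt_id s).const_mul c)).const_mul
      ((√c : ℝ) : ℂ)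
    rw [e3, Pi.smul_apply, e1, e2]
    refine Eq.trans ?_ h.deriv.symm
    rw [smul_eq_mul, mul_one, Complex.real_smul]
    ring

/-- Dilations are unitary, so the dilation of $u$ can be moved to the inverse dilation of the test
pair; differentiation accounts for the factor $c$. -/
theorem IsWeakDeriv.dilate {A B : Set ℝ} {c : ℝ} (hc : 0 < c) (hB : (fun s => c * s) ⁻¹' A = B)
    {u u' : L2 A} (hu : IsWeakDeriv A u u') :
    IsWeakDeriv B (dilate hc hB u) ((c : ℂ) • dilate hc hB u') := by
  have hd := inv_pos.2 hc
  have hA : (fun s => c⁻¹ * s) ⁻¹' B = A := by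
    rw [← hB, ← preimage_comp]
    ext s
    simp [hc.ne']
  rw [isWeakDeriv_iff] at hu ⊢
  intro p hp
  have h := hu _ (dilate_mem_testPairs hd hA hp)
  have e : ∀ q, ThinTube.dilate hc hB (ThinTube.dilate hd hA q) = q :=
    dilate_dilate hd hc (inv_mul_cancel₀ hc.ne') hA hB
  rw [← e p.1, ← e p.2, inner_smul_right, LinearIsometry.inner_map_map,
    LinearIsometry.inner_map_map]
  rw [inner_smul_left, Complex.conj_ofReal] at h
  have h2 : (c : ℂ) * ((c⁻¹ : ℝ) : ℂ) = 1 := by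
    rw [← Complex.ofReal_mul, mul_inv_cancel₀ hc.ne', Complex.ofReal_one]
  linear_combination (c : ℂ) * h - ⟪ThinTube.dilate hd hA p.2, u⟫_ℂ * h2

theorem IsH01.dilate {A B : Set ℝ} {c : ℝ} (hc : 0 < c) (hB : (fun s => c * s) ⁻¹' A = B)
    {u u' : L2 A} (hu : IsH01 A u u') :
    IsH01 B (dilate hc hB u) ((c : ℂ) • dilate hc hB u') := by
  rw [isH01_iff] at hu ⊢
  exact map_mem_closure (f := fun p : L2 A × L2 A =>
    (ThinTube.dilate hc hB p.1, (c : ℂ) • ThinTube.dilate hc hB p.2))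
    (by have h := (ThinTube.dilate hc hB).continuous; fun_prop) hu
    fun _ hp => dilate_mem_testPairs hc hB hp

/-- Two derivatives produce $c^2$, so the potential and the right-hand side must carry the same
factor. With $c=\sqrt\varepsilon$ this is the factor $\varepsilon$ in $\hat T_{\varepsilon,c}$. -/
theorem dilate_mem_schrodingerGraph {A B : Set ℝ} {c : ℝ} (hc : 0 < c)
    (hB : (fun s => c * s) ⁻¹' A = B) {V V' : ℝ → ℝ} (hV : ∀ s, V' s = c ^ 2 * V (c * s))
    {u f : L2 A} (h : (u, f) ∈ schrodingerGraph A V) :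
    (dilate hc hB u, ((c ^ 2 : ℝ) : ℂ) • dilate hc hB f) ∈ schrodingerGraph B V' := by
  obtain ⟨u', u'', Vu, h2, h01, hVu, hf⟩ := h
  simp only at h2 h01 hVu hf
  have h3 := (h2.2.dilate hc hB).smul (c : ℂ)
  rw [smul_smul, ← Complex.ofReal_mul, ← sq] at h3
  refine ⟨_, _, ((c ^ 2 : ℝ) : ℂ) • dilate hc hB Vu, ⟨h2.1.dilate hc hB, h3⟩, h01.dilate hc hB,
    ?_, ?_⟩
  · filter_upwards [dilate_coeFn hc hB u, dilate_coeFn hc hB Vu, ae_dilate hc hB hVu,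
      Lp.coeFn_smul ((c ^ 2 : ℝ) : ℂ) (dilate hc hB Vu)] with s e1 e2 e3 e4
    rw [e4, Pi.smul_apply, e2, e3, e1, hV, smul_eq_mul]
    push_cast
    ring
  · rw [hf, map_add, map_neg, smul_add, smul_neg]

theorem mem_graph_conjScale {H K : Type*} [NormedAddCommGroup H] [NormedSpace ℂ H]
    [NormedAddCommGroup K] [NormedSpace ℂ K] {J : H ≃ₗᵢ[ℂ] K} {t : ℂ} {A : H →ₗ.[ℂ] H} {v g : K} :
    (v, g) ∈ (conjScale J t A).graph ↔ ∃ f, (J.symm v, f) ∈ A.graph ∧ g = t • J f := by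
  simp only [LinearPMap.mem_graph_iff]
  constructor
  · rintro ⟨⟨y, hy⟩, h1, h2⟩
    simp only at h1
    subst h1
    exact ⟨A ⟨J.symm y, hy⟩, ⟨⟨J.symm y, hy⟩, rfl, rfl⟩, h2.symm⟩
  · rintro ⟨f, ⟨⟨y, hy⟩, h1, h2⟩, h3⟩
    simp only at h1 h2
    subst h1
    exact ⟨⟨v, hy⟩, rfl, by rw [h3, ← h2]; rfl⟩

/-- The two inclusions are the same dilation lemma, used with $c=\sqrt\varepsilon$ and
$c=1/\sqrt\varepsilon$. -/
theorem graph_conjScale_dilation (a b : ℝ) {ε : ℝ} (hε : 0 < ε) (V : ℝ → ℝ) :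
    (conjScale (dilation a b hε) (ε : ℂ) (schrodinger (Ioo (-a) b) V)).graph =
      (schrodinger (scaledInterval a b ε) fun s => ε * V (√ε * s)).graph := by
  have hs := Real.sqrt_pos.2 hε
  have hsq := Real.sq_sqrt hε.le
  ext ⟨v, g⟩
  rw [mem_graph_conjScale, schrodinger_graph isOpen_Ioo, schrodinger_graph (by exact isOpen_Ioo)]
  constructor
  · rintro ⟨f, hf, rfl⟩
    have h := dilate_mem_schrodingerGraph hs (preimage_interval a b hε)
      (V' := fun s => ε * V (√ε * s)) (fun s => by rw [hsq]) hf
    rw [hsq] at h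
    have e : dilate hs (preimage_interval a b hε) ((dilation a b hε).symm v) = v :=
      (dilation a b hε).apply_symm_apply v
    rwa [e] at h
  · intro h
    have h1 := dilate_mem_schrodingerGraph (inv_pos.2 hs) (preimage_scaled a b hε) (V' := V)
      (fun s => by
        rw [inv_pow, hsq, mul_inv_cancel_left₀ hs.ne', inv_mul_cancel_left₀ hε.ne']) h
    refine ⟨_, h1, ?_⟩
    have e : dilation a b hε (dilate (inv_pos.2 hs) (preimage_scaled a b hε) g) = g :=
      (dilation a b hε).apply_symm_apply g
    rw [map_smul, e, smul_smul, inv_pow, hsq, ← Complex.ofReal_mul, mul_inv_cancel₀ hε.ne',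
      Complex.ofReal_one, one_smul]

theorem isBoundedInverse_conjScale (a b : ℝ) {ε : ℝ} (hε : 0 < ε) {V : ℝ → ℝ}
    {R : L2 (scaledInterval a b ε) →L[ℂ] L2 (scaledInterval a b ε)}
    (hR : IsBoundedInverse (schrodinger (scaledInterval a b ε) fun s => ε * V (√ε * s)) R) :
    IsBoundedInverse (conjScale (dilation a b hε) (ε : ℂ) (schrodinger (Ioo (-a) b) V)) R := by
  rw [isBoundedInverse_iff] at hR ⊢
  rwa [graph_conjScale_dilation]

/-! ### Positivity of the lowest Dirichlet eigenvalue -/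

theorem norm_gradient (φ : Plane → ℝ) (y : Plane) : ‖gradient φ y‖ = ‖fderiv ℝ φ y‖ :=
  LinearIsometryEquiv.norm_map _ _

/-- The Poincaré inequality in a bounded planar domain. -/
theorem exists_eLpNorm_le_gradient {S : Set Plane}
    (hSb : Bornology.IsBounded S) : ∃ C : ℝ≥0∞, C ≠ ⊤ ∧ ∀ φ : Plane → ℝ, IsTest S φ →
      eLpNorm φ 2 (volume.restrict S) ≤ C * eLpNorm (gradient φ) 2 (volume.restrict S) := by
  have hfin : volume S ≠ ⊤ := hSb.measure_lt_top.ne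
  refine ⟨eLpNormLESNormFDerivOneConst (volume : Measure Plane) ((2 : NNReal) : ℝ) *
    (volume.restrict S univ) ^ (1 / (1 : ℝ≥0∞).toReal - 1 / (2 : ℝ≥0∞).toReal), ?_, ?_⟩
  · refine ENNReal.mul_ne_top ENNReal.coe_ne_top (ENNReal.rpow_ne_top_of_nonneg (by norm_num) ?_)
    rwa [Measure.restrict_apply_univ]
  intro φ hφ
  have hconj : NNReal.HolderConjugate (Module.finrank ℝ Plane) (2 : NNReal) := by
    rw [finrank_euclideanSpace, Fintype.card_fin]
    exact_mod_cast NNReal.HolderConjugate.two_two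
  -- The Gagliardo-Nirenberg-Sobolev inequality $\|\varphi\|_2\le C\|\nabla\varphi\|_1$ in dimension
  -- two, followed by Hölder on the finite-measure set $S$.
  have h1 := eLpNorm_le_eLpNorm_fderiv_one (volume : Measure Plane) (hφ.1.of_le (by simp)) hφ.2.1
    hconj
  have hsupp : Function.support (fderiv ℝ φ) ⊆ S :=
    (subset_tsupport _).trans ((tsupport_fderiv_subset ℝ).trans hφ.2.2)
  rw [← eLpNorm_restrict_eq_of_support_subset (f := fderiv ℝ φ) hsupp] at h1
  have hc : Continuous (fderiv ℝ φ) := hφ.1.continuous_fderiv (by simp)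
  have h2 := eLpNorm_le_eLpNorm_mul_rpow_measure_univ (μ := volume.restrict S) (f := fderiv ℝ φ)
    (p := 1) (q := 2) (by norm_num) hc.aestronglyMeasurable
  have h3 : eLpNorm (fderiv ℝ φ) 2 (volume.restrict S) =
      eLpNorm (gradient φ) 2 (volume.restrict S) :=
    eLpNorm_congr_norm_ae (.of_forall fun y => (norm_gradient φ y).symm)
  calc eLpNorm φ 2 (volume.restrict S) ≤ eLpNorm φ 2 volume :=
        eLpNorm_mono_measure _ Measure.restrict_le_self
    _ ≤ _ := h1
    _ ≤ _ := mul_le_mul_right h2 _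
    _ = _ := by rw [h3]; ring

/-- Testing the eigenvalue equation with approximants of $u_0$ gives $\lambda_0=\|\nabla u_0\|^2$ in
the limit. If this vanished, the Poincaré inequality would send the approximants to $0$, against
$\|u_0\|=1$. -/
theorem IsDirichletGroundState.eigenvalue_pos {S : Set Plane}
    (hSb : Bornology.IsBounded S) {lam0 : ℝ} {u0 : Plane → ℝ} {G0 : Plane → Plane}
    (h : IsDirichletGroundState S lam0 u0 G0) : 0 < lam0 := by
  obtain ⟨hu, hG, φ, hφ, h1, h2⟩ := h.eigen.h01
  have e1 : ∀ n, MemLp (φ n) 2 (volume.restrict S) := fun n =>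
    (hφ n).1.continuous.memLp_of_hasCompactSupport (hφ n).2.1
  have hgc : ∀ n, Continuous (gradient (φ n)) := fun n =>
    (LinearIsometryEquiv.continuous _).comp ((hφ n).1.continuous_fderiv (by simp))
  have e2 : ∀ n, MemLp (gradient (φ n)) 2 (volume.restrict S) := fun n => by
    refine (hgc n).memLp_of_hasCompactSupport ?_
    exact ((hφ n).2.1.fderiv (𝕜 := ℝ)).comp_left (map_zero (InnerProductSpace.toDual ℝ Plane).symm)
  have t1 : Tendsto (fun n => (e1 n).toLp _) atTop (𝓝 (hu.toLp u0)) :=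
    (Lp.tendsto_Lp_iff_tendsto_eLpNorm'' _ e1 _ hu).2 h1
  have t2 : Tendsto (fun n => (e2 n).toLp _) atTop (𝓝 (hG.toLp G0)) :=
    (Lp.tendsto_Lp_iff_tendsto_eLpNorm'' _ e2 _ hG).2 h2
  have key : ∀ n, inner ℝ (hG.toLp G0) ((e2 n).toLp _) =
      lam0 * inner ℝ (hu.toLp u0) ((e1 n).toLp _) := by
    intro n
    have a1 : inner ℝ (hG.toLp G0) ((e2 n).toLp _) =
        ∫ y in S, inner ℝ (G0 y) (gradient (φ n) y) := by
      rw [L2.inner_def]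
      refine integral_congr_ae ?_
      filter_upwards [hG.coeFn_toLp, (e2 n).coeFn_toLp] with y a1 a2
      rw [a1, a2]
    have a2 : inner ℝ (hu.toLp u0) ((e1 n).toLp _) = ∫ y in S, u0 y * φ n y := by
      rw [L2.inner_def]
      refine integral_congr_ae ?_
      filter_upwards [hu.coeFn_toLp, (e1 n).coeFn_toLp] with y a1 a2
      rw [a1, a2]
      simp [mul_comm]
    rw [a1, a2, h.eigen.weak (φ n) (hφ n)]
  have hlim : inner ℝ (hG.toLp G0) (hG.toLp G0) = lam0 * inner ℝ (hu.toLp u0) (hu.toLp u0) := by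
    refine tendsto_nhds_unique ((tendsto_const_nhds.inner t2).congr key) ?_
    exact (tendsto_const_nhds.inner t1).const_mul lam0
  have hnorm : inner ℝ (hu.toLp u0) (hu.toLp u0) = (1 : ℝ) := by
    rw [L2.inner_def, ← h.normalized]
    refine integral_congr_ae ?_
    filter_upwards [hu.coeFn_toLp] with y a1
    rw [a1]
    simp [sq]
  rw [hnorm, mul_one, real_inner_self_eq_norm_sq] at hlim
  rw [← hlim]
  refine pow_pos (norm_pos_iff.2 fun h0 => ?_) 2
  rw [h0] at t2
  obtain ⟨C, hC, hP⟩ := exists_eLpNorm_le_gradient hSb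
  have t3 : Tendsto (fun n => C * eLpNorm (gradient (φ n)) 2 (volume.restrict S)) atTop (𝓝 0) := by
    have := ENNReal.Tendsto.const_mul (a := C) (Lp.tendsto_Lp_iff_tendsto_eLpNorm' _ _ |>.1 t2)
      (.inr hC)
    rw [mul_zero] at this
    refine this.congr fun n => ?_
    congr 1
    refine eLpNorm_congr_ae ?_
    filter_upwards [(e2 n).coeFn_toLp, Lp.coeFn_zero Plane 2 (volume.restrict S)] with y a1 a2
    rw [Pi.sub_apply, a1, a2, Pi.zero_apply, sub_zero]
  have t4 : Tendsto (fun n => eLpNorm (φ n) 2 (volume.restrict S)) atTop (𝓝 0) :=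
    tendsto_of_tendsto_of_tendsto_of_le_of_le tendsto_const_nhds t3 (fun _ => zero_le)
      fun n => hP _ (hφ n)
  have t5 : Tendsto (fun n => (e1 n).toLp _) atTop (𝓝 (0 : Lp ℝ 2 (volume.restrict S))) := by
    rw [Lp.tendsto_Lp_iff_tendsto_eLpNorm']
    refine t4.congr fun n => eLpNorm_congr_ae ?_
    filter_upwards [(e1 n).coeFn_toLp, Lp.coeFn_zero ℝ 2 (volume.restrict S)] with y a1 a2
    rw [Pi.sub_apply, a1, a2, Pi.zero_apply, sub_zero]
  rw [tendsto_nhds_unique t1 t5, inner_zero_left] at hnorm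
  exact zero_ne_one hnorm

/-! ### Cutoff functions -/

/-- Rescaling one bump function keeps $D$ independent of $L$. The last bound holds because $\chi=1$
on $[-L,L]$; it converts control of $su$ into smallness of $(1-\chi)u$. -/
theorem exists_cutoff : ∃ D : ℝ, ∀ L : ℝ, 0 < L → ∃ χ χ' : ℝ → ℝ, ContDiff ℝ ∞ χ ∧
    (∀ s, HasDerivAt χ (χ' s) s) ∧ tsupport χ ⊆ Icc (-(2 * L)) (2 * L) ∧ (∀ s, |χ s| ≤ 1) ∧
    (∀ s, |χ' s| ≤ D / L) ∧ ∀ s, |1 - χ s| ≤ 1 / L * |s| := by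
  let f : ContDiffBump (0 : ℝ) := ⟨1, 2, one_pos, one_lt_two⟩
  have hf : ContDiff ℝ ∞ f := f.contDiff
  obtain ⟨D, hD⟩ := (hf.continuous_deriv (by simp)).bounded_above_of_compact_support
    f.hasCompactSupport.deriv
  refine ⟨D, fun L hL => ⟨fun s => f (s / L), fun s => deriv f (s / L) / L,
    hf.comp (contDiff_id.div_const L), fun s => ?_, ?_, fun s => ?_, fun s => ?_, fun s => ?_⟩⟩
  · have h := ((hf.differentiable (by simp) (s / L)).hasDerivAt).comp s
      ((hasDerivAt_id s).div_const L)
    rwa [mul_one_div] at h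
  · refine (tsupport_comp_subset_preimage f (f := fun s => s / L) (by fun_prop)).trans ?_
    rw [f.tsupport_eq]
    intro s hs
    rw [mem_preimage, mem_closedBall_zero_iff, Real.norm_eq_abs, abs_div, abs_of_pos hL,
      div_le_iff₀ hL] at hs
    exact abs_le.1 hs
  · rw [abs_of_nonneg f.nonneg]
    exact f.le_one
  · rw [abs_div, abs_of_pos hL]
    exact div_le_div_of_nonneg_right (hD _) hL.le
  · rcases le_or_gt |s| L with h | h
    · have : f (s / L) = 1 := f.one_of_mem_closedBall (by
        rw [mem_closedBall_zero_iff, Real.norm_eq_abs, abs_div, abs_of_pos hL]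
        exact (div_le_one hL).2 h)
      simp only [this, sub_self, abs_zero]
      positivity
    · have h1 : 1 ≤ 1 / L * |s| := by
        rw [one_div, ← div_eq_inv_mul, le_div_iff₀ hL]
        linarith
      refine le_trans ?_ h1
      rw [abs_le]
      constructor <;> linarith [f.nonneg (x := s / L), f.le_one (x := s / L)]

/-! ### The effective potential -/

/-- The neighbourhood in the expansion contains $0$, where the error term vanishes. -/
theorem IsDeformation.apply_zero {I : Set ℝ} {h : ℝ → ℝ} {M : ℝ} (hh : IsDeformation I h M) :
    h 0 = M := by
  obtain ⟨C, hC⟩ := hh.expansion.bound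
  have := hC.self_of_nhds
  norm_num at this
  linarith

/-- Global form of the expansion of `h` at its maximum. -/
theorem IsDeformation.exists_expansion {a b : ℝ} (ha : 0 < a) (hb : 0 < b) {h : ℝ → ℝ} {M : ℝ}
    (hh : IsDeformation (Icc (-a) b) h M) :
    ∃ C δ : ℝ, 0 < C ∧ 0 < δ ∧ ∀ t ∈ Icc (-a) b,
      |M - h t - t ^ 2| ≤ C * |t| ^ 3 ∧ δ * t ^ 2 ≤ M - h t := by
  set R := a + b with hR
  have hRpos : 0 < R := by positivity
  have htR : ∀ t ∈ Icc (-a) b, |t| ≤ R := fun t ht => abs_le.2 ⟨by linarith [ht.1], by linarith [ht.2]⟩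
  have h0I : (0 : ℝ) ∈ Icc (-a) b := ⟨by linarith, hb.le⟩
  have h0 := hh.apply_zero
  have hle : ∀ t ∈ Icc (-a) b, h t ≤ M := fun t ht => by
    rcases eq_or_ne t 0 with rfl | hne
    · exact h0.le
    · exact h0 ▸ (hh.unique_max t ht hne).le
  obtain ⟨C₀, hC₀⟩ := hh.expansion.bound
  obtain ⟨t₀, ht₀, hball⟩ := Metric.eventually_nhds_iff.1 hC₀
  have hnear : ∀ t, |t| < t₀ → |M - h t - t ^ 2| ≤ C₀ * |t| ^ 3 := fun t ht => by
    have := hball (y := t) (by simpa using ht)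
    rw [Real.norm_eq_abs, Real.norm_eq_abs, abs_of_nonneg (pow_nonneg (abs_nonneg t) 3)] at this
    rwa [show M - h t - t ^ 2 = -(h t - (M - t ^ 2)) by ring, abs_neg]
  have hM := hh.M_pos
  -- Away from $0$ the remainder is at most $M+R^2$, since $0<h\le M$ and $|t|\le R$; dividing by
  -- $t_0^3$ makes it cubic.
  obtain ⟨C, hC, hCC₀, hCM⟩ : ∃ C : ℝ, 0 < C ∧ C₀ ≤ C ∧ (M + R ^ 2) / t₀ ^ 3 ≤ C :=
    ⟨max (max C₀ ((M + R ^ 2) / t₀ ^ 3)) 1, by positivity,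
      (le_max_left _ _).trans (le_max_left _ _), (le_max_right _ _).trans (le_max_left _ _)⟩
  have hglob : ∀ t ∈ Icc (-a) b, |M - h t - t ^ 2| ≤ C * |t| ^ 3 := fun t ht => by
    rcases lt_or_ge |t| t₀ with hlt | hge
    · exact (hnear t hlt).trans (by gcongr)
    · have h1 : |M - h t - t ^ 2| ≤ M + R ^ 2 := by
        have := hh.pos t ht
        have := hle t ht
        have h2 : t ^ 2 ≤ R ^ 2 := sq_le_sq' (by linarith [(abs_le.1 (htR t ht)).1])
          (abs_le.1 (htR t ht)).2
        rw [abs_le]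
        constructor <;> nlinarith [sq_nonneg t]
      have h3 : M + R ^ 2 ≤ C * t₀ ^ 3 := (div_le_iff₀ (by positivity)).1 hCM
      exact h1.trans (h3.trans (by gcongr))
  -- For $|t|<t_1$ the cubic error is at most $t^2/2$, so $M-h\ge t^2/2$. For $|t|\ge t_1$
  -- compactness and the strict maximum give a positive gap $d$.
  set t₁ := 1 / (2 * C) with ht₁
  have ht₁pos : 0 < t₁ := by positivity
  have hfar : ∃ d : ℝ, 0 < d ∧ ∀ t ∈ Icc (-a) b, t₁ ≤ |t| → d ≤ M - h t := by
    set J := Icc (-a) b ∩ {t | t₁ ≤ |t|} with hJ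
    have hJc : IsCompact J := isCompact_Icc.inter_right (isClosed_le continuous_const continuous_abs)
    rcases J.eq_empty_or_nonempty with he | hne
    · exact ⟨1, one_pos, fun t ht h1 => absurd (he ▸ (⟨ht, h1⟩ : t ∈ J)) (notMem_empty t)⟩
    · obtain ⟨x, hx, hmax⟩ := hJc.exists_isMaxOn hne (hh.continuousOn.mono inter_subset_left)
      have hx0 : x ≠ 0 := fun h => by
        have := hx.2
        rw [h, mem_ofPred_eq, abs_zero] at this
        linarith
      refine ⟨M - h x, by linarith [hh.unique_max x hx.1 hx0], fun t ht h1 => ?_⟩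
      have : h t ≤ h x := hmax (⟨ht, h1⟩ : t ∈ J)
      linarith
  obtain ⟨d, hd, hfar⟩ := hfar
  refine ⟨C, min (1 / 2) (d / R ^ 2), hC, lt_min (by norm_num) (by positivity), fun t ht =>
    ⟨hglob t ht, ?_⟩⟩
  rcases lt_or_ge |t| t₁ with hlt | hge
  · have h1 := (abs_le.1 (hglob t ht)).1
    have h2 : C * |t| ^ 3 ≤ 1 / 2 * t ^ 2 := by
      rw [pow_succ, sq_abs]
      have : C * |t| ≤ 1 / 2 := by
        calc C * |t| ≤ C * t₁ := by gcongr
          _ = 1 / 2 := by rw [ht₁]; field_simp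
      nlinarith [sq_nonneg t]
    calc min (1 / 2) (d / R ^ 2) * t ^ 2 ≤ 1 / 2 * t ^ 2 := by gcongr; exact min_le_left _ _
      _ ≤ _ := by linarith
  · calc min (1 / 2) (d / R ^ 2) * t ^ 2 ≤ d / R ^ 2 * R ^ 2 := by
          have : t ^ 2 ≤ R ^ 2 := by rw [← sq_abs]; gcongr; exact htR t ht
          gcongr
          exact min_le_right _ _
      _ = d := by field_simp
      _ ≤ _ := hfar t ht hge

/-- For $0<h\le M$ the factor $(M+h)/(M^2h^2)$ multiplying $M-h$ is at least $1/M^3$, which gives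
the lower bound; the others follow from a Taylor expansion of $h^{-2}$ at $M$. -/
theorem IsDeformation.exists_potential_bounds {a b : ℝ} (ha : 0 < a) (hb : 0 < b) {h : ℝ → ℝ}
    {M : ℝ} (hh : IsDeformation (Icc (-a) b) h M) :
    ∃ δ C₁ C₂ : ℝ, 0 < δ ∧ 0 ≤ C₁ ∧ 0 ≤ C₂ ∧ ∀ t ∈ Icc (-a) b,
      δ * t ^ 2 ≤ 1 / h t ^ 2 - 1 / M ^ 2 ∧ 1 / h t ^ 2 - 1 / M ^ 2 ≤ C₂ * t ^ 2 ∧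
      |1 / h t ^ 2 - 1 / M ^ 2 - 2 / M ^ 3 * t ^ 2| ≤ C₁ * |t| ^ 3 := by
  obtain ⟨C, δ, hC, hδ, hCδ⟩ := hh.exists_expansion ha hb
  set R := a + b with hR
  have hRpos : 0 < R := by positivity
  have htR : ∀ t ∈ Icc (-a) b, |t| ≤ R := fun t ht =>
    abs_le.2 ⟨by linarith [ht.1], by linarith [ht.2]⟩
  have hM := hh.M_pos
  obtain ⟨x, hx, hmin⟩ := isCompact_Icc.exists_isMinOn (⟨0, by linarith, hb.le⟩ : (Icc (-a) b).Nonempty)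
    hh.continuousOn
  set q := h x with hq
  have hqpos : 0 < q := hh.pos x hx
  set E := (1 + C * R) ^ 2 * R * (3 * M) / (M ^ 3 * q ^ 2) + 2 * C / M ^ 3 with hE
  have hEpos : 0 ≤ E := by positivity
  have third : ∀ t ∈ Icc (-a) b, |1 / h t ^ 2 - 1 / M ^ 2 - 2 / M ^ 3 * t ^ 2| ≤ E * |t| ^ 3 := by
    intro t ht
    have ht0 := hh.pos t ht
    have hqt : q ≤ h t := hmin ht
    obtain ⟨h1, h2⟩ := hCδ t ht
    have htM : h t ≤ M := by nlinarith [sq_nonneg t]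
    -- First-order expansion of $h^{-2}$ at $M$ with exact remainder. As $M-h=O(t^2)$, the quadratic
    -- term is $O(t^4)$, hence $O(|t|^3)$ on the bounded interval.
    have hid : 1 / h t ^ 2 - 1 / M ^ 2 - 2 / M ^ 3 * t ^ 2 =
        (M - h t) ^ 2 * (M + 2 * h t) / (M ^ 3 * h t ^ 2)
          + 2 / M ^ 3 * (M - h t - t ^ 2) := by
      field_simp
      ring
    have hd : M - h t ≤ (1 + C * R) * t ^ 2 := by
      have h3 := (abs_le.1 h1).2
      have h4 : C * |t| ^ 3 ≤ C * R * t ^ 2 := by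
        rw [pow_succ, sq_abs, mul_comm (t ^ 2), ← mul_assoc]
        gcongr
        exact htR t ht
      linarith
    have hd2 : (M - h t) ^ 2 ≤ (1 + C * R) ^ 2 * R * |t| ^ 3 := by
      calc (M - h t) ^ 2 ≤ ((1 + C * R) * t ^ 2) ^ 2 := by
            gcongr
        _ = (1 + C * R) ^ 2 * (|t| * |t| ^ 3) := by rw [← sq_abs t]; ring
        _ ≤ (1 + C * R) ^ 2 * (R * |t| ^ 3) := by gcongr; exact htR t ht
        _ = _ := by ring
    have hfirst : (M - h t) ^ 2 * (M + 2 * h t) / (M ^ 3 * h t ^ 2) ≤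
        (1 + C * R) ^ 2 * R * |t| ^ 3 * (3 * M) / (M ^ 3 * q ^ 2) := by
      gcongr
      linarith
    have hfirst0 : 0 ≤ (M - h t) ^ 2 * (M + 2 * h t) / (M ^ 3 * h t ^ 2) := by positivity
    rw [hid]
    refine (abs_add_le _ _).trans ?_
    rw [abs_of_nonneg hfirst0, abs_mul, abs_of_pos (by positivity : 0 < 2 / M ^ 3)]
    calc _ ≤ (1 + C * R) ^ 2 * R * |t| ^ 3 * (3 * M) / (M ^ 3 * q ^ 2)
          + 2 / M ^ 3 * (C * |t| ^ 3) := by gcongr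
      _ = _ := by rw [hE]; ring
  refine ⟨δ / M ^ 3, E, 2 / M ^ 3 + E * R, by positivity, hEpos, by positivity, fun t ht =>
    ⟨?_, ?_, third t ht⟩⟩
  · have ht0 := hh.pos t ht
    have h2 := (hCδ t ht).2
    have htM : h t ≤ M := by nlinarith [sq_nonneg t]
    have hid : 1 / h t ^ 2 - 1 / M ^ 2 = (M - h t) * (M + h t) / (M ^ 2 * h t ^ 2) := by
      field_simp
      ring
    rw [hid]
    calc δ / M ^ 3 * t ^ 2 = δ * t ^ 2 * M / (M ^ 2 * M ^ 2) := by field_simp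
      _ ≤ (M - h t) * (M + h t) / (M ^ 2 * h t ^ 2) := by
        have h0 : 0 ≤ M - h t := by linarith
        gcongr
        linarith
  · have h1 := (abs_le.1 (third t ht)).2
    have h2 : E * |t| ^ 3 ≤ E * R * t ^ 2 := by
      rw [pow_succ, sq_abs, mul_comm (t ^ 2), ← mul_assoc]
      gcongr
      exact htR t ht
    linarith

/-! ### Measurability and bounds of the coefficients -/

theorem aestronglyMeasurable_derivWithin_Icc (f : ℝ → ℝ) (a b : ℝ) :
    AEStronglyMeasurable (derivWithin f (Icc a b)) (volume.restrict (Ioo a b)) := by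
  refine (measurable_deriv f).aestronglyMeasurable.congr ?_
  filter_upwards [ae_restrict_mem measurableSet_Ioo] with s hs
  exact (derivWithin_of_mem_nhds (Icc_mem_nhds hs.1 hs.2)).symm

theorem IsFrenetCurve.continuousOn_curvature {a b : ℝ} (hab : a < b) {r N B : ℝ → Space}
    {k τ : ℝ → ℝ} (hc : IsFrenetCurve (Icc a b) r N B k τ) : ContinuousOn k (Icc a b) := by
  have hu := uniqueDiffOn_Icc hab
  have h1 : ContDiffOn ℝ 1 (derivWithin r (Icc a b)) (Icc a b) :=
    hc.contDiffOn.derivWithin hu (by norm_num)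
  exact (h1.continuousOn_derivWithin hu le_rfl).norm.congr hc.curvature

/-- No regularity of $\tau$ is assumed, but $\tau=-\langle B',N\rangle$ with $N$ continuous, and a
derivative is measurable. -/
theorem IsFrenetCurve.aestronglyMeasurable_torsion {a b : ℝ} {r N B : ℝ → Space}
    {k τ : ℝ → ℝ} (hc : IsFrenetCurve (Icc a b) r N B k τ) :
    AEStronglyMeasurable τ (volume.restrict (Ioo a b)) := by
  have hN : ContinuousOn N (Ioo a b) := fun s hs =>
    ((hc.frenet_normal s (Ioo_subset_Icc_self hs)).continuousWithinAt).mono Ioo_subset_Icc_self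
  have h : AEStronglyMeasurable (fun s => -inner ℝ (deriv B s) (N s)) (volume.restrict (Ioo a b)) :=
    ((measurable_deriv B).aestronglyMeasurable.inner
      (hN.aestronglyMeasurable measurableSet_Ioo)).neg
  refine h.congr ?_
  filter_upwards [ae_restrict_mem measurableSet_Ioo] with s hs
  have hs' := Ioo_subset_Icc_self hs
  have h1 := ((hc.frenet_binormal s hs').hasDerivAt (Icc_mem_nhds hs.1 hs.2)).deriv
  rw [h1, inner_smul_left, real_inner_self_eq_norm_sq, hc.norm_normal s hs']
  simp

theorem exists_abs_vartheta_le {I : Set ℝ} {S : Set Plane} {G0 : Plane → Plane} {τ α h : ℝ → ℝ}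
    {μ : Measure ℝ} (hτ : ∃ C : ℝ, ∀ᵐ s ∂μ, |τ s| ≤ C)
    (hα : ∃ C : ℝ, ∀ᵐ s ∂μ, |derivWithin α I s| ≤ C)
    (hh : ∃ C : ℝ, ∀ᵐ s ∂μ, |derivWithin h I s / h s| ≤ C) (c : ℝ) :
    ∃ C : ℝ, 0 ≤ C ∧ ∀ᵐ s ∂μ, |vartheta I S G0 τ α h s + c| ≤ C := by
  obtain ⟨A, hA⟩ := hτ
  obtain ⟨B, hB⟩ := hα
  obtain ⟨D, hD⟩ := hh
  refine ⟨|C1 S G0| * (|A| + |B|) ^ 2 + |C2 S G0 - 1| * |D| ^ 2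
    + 2 * |C3 S G0| * (|A| + |B|) * |D| + |c|, by positivity, ?_⟩
  filter_upwards [hA, hB, hD] with s h1 h2 h3
  have e1 : |τ s + derivWithin α I s| ≤ |A| + |B| :=
    (abs_add_le _ _).trans (add_le_add (h1.trans (le_abs_self A)) (h2.trans (le_abs_self B)))
  have e2 : |derivWithin h I s / h s| ≤ |D| := h3.trans (le_abs_self D)
  unfold vartheta
  refine (abs_add_le _ _).trans (add_le_add_left ((abs_sub _ _).trans (add_le_add
    ((abs_add_le _ _).trans (add_le_add ?_ ?_)) ?_)) _)
  · rw [abs_mul, abs_pow]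
    gcongr
  · rw [abs_mul, abs_pow]
    gcongr
  · rw [abs_mul, abs_mul, abs_mul, abs_two]
    gcongr

theorem continuousOn_zeta {I : Set ℝ} {S : Set Plane} {u0 : Plane → ℝ} {k α h : ℝ → ℝ}
    (hk : ContinuousOn k I) (hα : ContinuousOn α I) (hh : ContinuousOn h I) (ε : ℝ) :
    ContinuousOn (zeta S u0 k α h ε) I := by
  have e : zeta S u0 k α h ε = fun s => 1 - ε * k s * h s *
      (F S u0 0 * Real.cos (α s) + F S u0 1 * -Real.sin (α s)) := by
    funext s
    simp [zeta, PiLp.inner_apply, Fin.sum_univ_two]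
  rw [e]
  fun_prop

/-- $\zeta_\varepsilon-1$ is linear in $\varepsilon$, so the maximum for $\varepsilon=1$ on the
compact interval suffices. -/
theorem exists_abs_zeta_sub_one_le {I : Set ℝ} (hI : IsCompact I) {S : Set Plane}
    {u0 : Plane → ℝ} {k α h : ℝ → ℝ} (hk : ContinuousOn k I) (hα : ContinuousOn α I)
    (hh : ContinuousOn h I) :
    ∃ C : ℝ, 0 ≤ C ∧ ∀ ε, 0 < ε → ∀ t ∈ I, |zeta S u0 k α h ε t - 1| ≤ ε * C := by
  obtain ⟨C, hC⟩ := hI.exists_bound_of_continuousOn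
    ((continuousOn_zeta (S := S) (u0 := u0) hk hα hh 1).sub (continuousOn_const (c := (1 : ℝ))))
  refine ⟨|C|, abs_nonneg _, fun ε hε t ht => ?_⟩
  have h1 : zeta S u0 k α h ε t - 1 = ε * (zeta S u0 k α h 1 t - 1) := by
    unfold zeta
    ring
  rw [h1, abs_mul, abs_of_pos hε]
  exact mul_le_mul_of_nonneg_left ((hC t ht).trans (le_abs_self C)) hε.le

theorem aestronglyMeasurable_dilate {A B : Set ℝ} {c : ℝ} (hc : 0 < c)
    (hB : (fun s => c * s) ⁻¹' A = B) {f : ℝ → ℝ}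
    (hf : AEStronglyMeasurable f (volume.restrict A)) :
    AEStronglyMeasurable (fun s => f (c * s)) (volume.restrict B) := by
  have h : AEStronglyMeasurable f (Measure.map (fun s => c * s) (volume.restrict B)) := by
    rw [map_mul_restrict hc hB]
    exact hf.smul_measure _
  exact h.comp_measurable (measurable_const_mul c)

/-- Estimates for the rescaled potential `ε W_ε(√ε s)`, where `W_ε = Θ + ζ λ₀ p / ε²`. -/
theorem scaled_potential_bounds {lam ε θ ζ p δ C₁ C₂ Cθ Cζ ν s t : ℝ} (hlam : 0 < lam)
    (hε : 0 < ε) (ht : t = √ε * s) (hθ : |θ| ≤ Cθ) (hζ : |ζ - 1| ≤ ε * Cζ) (hεζ : ε * Cζ ≤ 1 / 2)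
    (hδ : 0 < δ) (h1 : δ * t ^ 2 ≤ p) (h2 : p ≤ C₂ * t ^ 2)
    (h3 : |p - ν * t ^ 2| ≤ C₁ * |t| ^ 3) :
    lam * δ / 2 * s ^ 2 - ε * Cθ ≤ ε * (θ + ζ * (lam / ε ^ 2 * p)) ∧
    |ε * (θ + ζ * (lam / ε ^ 2 * p)) - lam * ν * s ^ 2| ≤
      ε * Cθ + lam * C₁ * √ε * |s| ^ 3 + ε * (lam * Cζ * C₂ * s ^ 2) := by
  have hs := Real.sqrt_pos.2 hε
  have hsq := Real.sq_sqrt hε.le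
  have ht2 : t ^ 2 = ε * s ^ 2 := by rw [ht, mul_pow, hsq]
  have ht3 : |t| ^ 3 = ε * √ε * |s| ^ 3 := by
    rw [ht, abs_mul, abs_of_pos hs, mul_pow, pow_succ, hsq]
  have hp : 0 ≤ p := le_trans (by positivity) h1
  have hV : ε * (θ + ζ * (lam / ε ^ 2 * p)) = ε * θ + ζ * (lam / ε * p) := by
    field_simp
  rw [hV]
  have hθ1 := abs_le.1 hθ
  have hζ1 := abs_le.1 hζ
  constructor
  · have e1 : 1 / 2 ≤ ζ := by linarith
    have e2 : lam / ε * (δ * t ^ 2) ≤ lam / ε * p := by gcongr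
    have e3 : lam / ε * (δ * t ^ 2) = lam * δ * s ^ 2 := by
      rw [ht2]
      field_simp
    have e4 : 0 ≤ lam / ε * p := by positivity
    nlinarith
  · have e1 : ε * θ + ζ * (lam / ε * p) - lam * ν * s ^ 2 =
        ε * θ + lam / ε * (p - ν * t ^ 2) + (ζ - 1) * (lam / ε * p) := by
      rw [ht2]
      field_simp
      ring
    have e2 : |ε * θ| ≤ ε * Cθ := by
      rw [abs_mul, abs_of_pos hε]
      gcongr
    have e3 : |lam / ε * (p - ν * t ^ 2)| ≤ lam * C₁ * √ε * |s| ^ 3 := by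
      rw [abs_mul, abs_of_pos (by positivity : 0 < lam / ε)]
      calc lam / ε * |p - ν * t ^ 2| ≤ lam / ε * (C₁ * |t| ^ 3) := by gcongr
        _ = _ := by rw [ht3]; field_simp
    have e4 : |(ζ - 1) * (lam / ε * p)| ≤ ε * (lam * Cζ * C₂ * s ^ 2) := by
      rw [abs_mul, abs_of_nonneg (by positivity : 0 ≤ lam / ε * p)]
      have hCζ : 0 ≤ ε * Cζ := (abs_nonneg _).trans hζ
      calc |ζ - 1| * (lam / ε * p) ≤ (ε * Cζ) * (lam / ε * (C₂ * t ^ 2)) := by gcongr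
        _ = _ := by rw [ht2]; field_simp
    rw [e1]
    exact (abs_add_le _ _).trans (add_le_add ((abs_add_le _ _).trans (add_le_add e2 e3)) e4)

/-- Norm comparison of the inverses from the comparison of solutions. -/
theorem norm_sumZero_sub_le {Ω : Set ℝ} (hΩ : MeasurableSet Ω) {V V' : ℝ → ℝ} {K K' : ℝ}
    (hK' : 0 ≤ K') {T : L2 univ →L[ℂ] L2 univ} {R : L2 Ω →L[ℂ] L2 Ω}
    (hT : ∀ f, ∃ u' Vu w, IsFormSolution univ V K f (T f) u' Vu w)
    (hR : ∀ f, ∃ u' Vu w, IsFormSolution Ω V' K' f (R f) u' Vu w)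
    {χ χ' : ℝ → ℝ} (hχ : ContDiff ℝ ∞ χ) (hχ' : ∀ s, HasDerivAt χ (χ' s) s)
    (hsupp : tsupport χ ⊆ Ω) (hχb : ∀ s, |χ s| ≤ 1) {D L θ : ℝ} (hθ : 0 ≤ θ)
    (hχ'b : ∀ s, |χ' s| ≤ D) (hL : 0 < L) (hχL : ∀ s, |1 - χ s| ≤ 1 / L * |s|)
    (hVm : AEStronglyMeasurable (fun s => V s - V' s) (volume.restrict Ω))
    (hVV : ∀ᵐ s ∂(volume.restrict Ω), |χ s * (V s - V' s)| ≤ θ) {E : ℝ} (hE0 : 0 ≤ E)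
    (hE : (K + K') / L + 2 * D * K * K' + θ * K * K' ≤ E) :
    ‖sumZero hΩ R - T‖ ≤ E := by
  refine ContinuousLinearMap.opNorm_le_bound _ hE0 fun f => ?_
  -- With this $g$ and the symmetry of $R$, the compared quantity becomes $\langle g,g\rangle$, and
  -- one factor $\|g\|$ divides out.
  set g := (sumZero hΩ R - T) f with hg
  obtain ⟨u', Vu, y, hu⟩ := hT f
  obtain ⟨w', Vw, z, hw⟩ := hR (restrictL2 Ω g)
  obtain ⟨v', Vv, x, hv⟩ := hR (restrictL2 Ω f)
  have h1 := norm_inner_sub_le hΩ hK' hu hw hχ hχ' hsupp hχb hθ hχ'b hL hχL hVm hVV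
  have h2 : ⟪R (restrictL2 Ω g), restrictL2 Ω f⟫_ℂ - ⟪g, T f⟫_ℂ = ⟪g, g⟫_ℂ := by
    rw [← hv.inner_symm hw, ← inner_conj_symm, ← inner_extendL2 hΩ, inner_conj_symm,
      ← inner_sub_right]
    rfl
  rw [h2] at h1
  have h3 : ‖g‖ ^ 2 ≤ ‖⟪g, g⟫_ℂ‖ := by
    rw [← re_inner_self]
    exact Complex.re_le_norm _
  have h4 : ‖g‖ ^ 2 ≤ E * (‖f‖ * ‖g‖) := h3.trans (h1.trans (by gcongr))
  rcases (norm_nonneg g).eq_or_lt with h | h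
  · rw [← h]
    positivity
  · nlinarith

theorem aestronglyMeasurable_effPotential {a b : ℝ} {r N B : ℝ → Space} {k τ α h : ℝ → ℝ}
    (hab : -a < b) (hcurve : IsFrenetCurve (Icc (-a) b) r N B k τ)
    (hα : ContinuousOn α (Icc (-a) b)) (hh : ContinuousOn h (Icc (-a) b)) (S : Set Plane)
    (lam0 : ℝ) (u0 : Plane → ℝ) (G0 : Plane → Plane) (M c ε : ℝ) :
    AEStronglyMeasurable (effPotential (Icc (-a) b) S lam0 u0 G0 k τ α h M c ε)
      (volume.restrict (Ioo (-a) b)) := by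
  have hI : Ioo (-a) b ⊆ Icc (-a) b := Ioo_subset_Icc_self
  have mτ := hcurve.aestronglyMeasurable_torsion.aemeasurable
  have mα := (aestronglyMeasurable_derivWithin_Icc α (-a) b).aemeasurable
  have mh' := (aestronglyMeasurable_derivWithin_Icc h (-a) b).aemeasurable
  have mh := ((hh.mono hI).aestronglyMeasurable measurableSet_Ioo (μ := volume)).aemeasurable
  have mζ := (((continuousOn_zeta (S := S) (u0 := u0) (hcurve.continuousOn_curvature hab) hα hh
    ε).mono hI).aestronglyMeasurable measurableSet_Ioo (μ := volume)).aemeasurable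
  unfold effPotential vartheta
  refine AEMeasurable.aestronglyMeasurable ?_
  fun_prop

/-- Bounds for the rescaled effective potential, uniform in `ε`. -/
theorem exists_effPotential_bounds {a b : ℝ} (ha : 0 < a) (hb : 0 < b)
    {r N B : ℝ → Space} {k τ α h : ℝ → ℝ} {M : ℝ}
    (hcurve : IsFrenetCurve (Icc (-a) b) r N B k τ)
    (hτ : ∃ C : ℝ, ∀ᵐ s ∂(volume.restrict (Icc (-a) b)), |τ s| ≤ C)
    (hα : DifferentiableOn ℝ α (Icc (-a) b))
    (hα' : ∃ C : ℝ, ∀ᵐ s ∂(volume.restrict (Icc (-a) b)), |derivWithin α (Icc (-a) b) s| ≤ C)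
    (hh : IsDeformation (Icc (-a) b) h M) (S : Set Plane) {lam0 : ℝ} (hlam : 0 < lam0)
    (u0 : Plane → ℝ) (G0 : Plane → Plane) (c : ℝ) :
    ∃ δ A₁ A₂ A₃ ε₁ : ℝ, 0 < δ ∧ 0 ≤ A₁ ∧ 0 ≤ A₂ ∧ 0 ≤ A₃ ∧ 0 < ε₁ ∧ ∀ ε, 0 < ε → ε < ε₁ →
      ∀ᵐ s ∂(volume.restrict (scaledInterval a b ε)),
        δ * s ^ 2 - ε * A₁ ≤
          ε * effPotential (Icc (-a) b) S lam0 u0 G0 k τ α h M c ε (√ε * s) ∧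
        |ε * effPotential (Icc (-a) b) S lam0 u0 G0 k τ α h M c ε (√ε * s)
          - 2 * lam0 / M ^ 3 * s ^ 2| ≤ ε * A₁ + √ε * (A₂ * |s| ^ 3) + ε * (A₃ * s ^ 2) := by
  have hab : -a < b := by linarith
  obtain ⟨Cθ, hCθ, hθ⟩ := exists_abs_vartheta_le (S := S) (G0 := G0) hτ hα' hh.bounded c
  obtain ⟨Cζ, hCζ, hζ⟩ := exists_abs_zeta_sub_one_le isCompact_Icc (S := S) (u0 := u0)
    (hcurve.continuousOn_curvature hab) hα.continuousOn hh.continuousOn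
  obtain ⟨δ, C₁, C₂, hδ, hC₁, hC₂, hp⟩ := hh.exists_potential_bounds ha hb
  -- The threshold $\varepsilon_1$ ensures $\varepsilon C_\zeta\le1/2$; the $+1$ avoids a zero
  -- denominator.
  refine ⟨lam0 * δ / 2, Cθ, lam0 * C₁, lam0 * Cζ * C₂, 1 / (2 * (Cζ + 1)), by positivity, hCθ,
    by positivity, by positivity, by positivity, fun ε hε hε₁ => ?_⟩
  have hεζ : ε * Cζ ≤ 1 / 2 := by
    rw [lt_div_iff₀ (by positivity)] at hε₁
    nlinarith
  have hθ' : ∀ᵐ s ∂(volume.restrict (Ioo (-a) b)),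
      |vartheta (Icc (-a) b) S G0 τ α h s + c| ≤ Cθ :=
    ae_mono (Measure.restrict_mono Ioo_subset_Icc_self le_rfl) hθ
  have hae := ae_dilate (Real.sqrt_pos.2 hε) (preimage_interval a b hε)
    (hθ'.and (ae_restrict_mem measurableSet_Ioo))
  filter_upwards [hae] with s hs
  obtain ⟨h1, h2⟩ := hs
  have hmem := Ioo_subset_Icc_self h2
  obtain ⟨p1, p2, p3⟩ := hp _ hmem
  have e : effPotential (Icc (-a) b) S lam0 u0 G0 k τ α h M c ε (√ε * s) =
      vartheta (Icc (-a) b) S G0 τ α h (√ε * s) + c + zeta S u0 k α h ε (√ε * s) *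
        (lam0 / ε ^ 2 * (1 / h (√ε * s) ^ 2 - 1 / M ^ 2)) := by
    unfold effPotential
    ring
  have := scaled_potential_bounds hlam hε rfl h1 (hζ ε hε _ hmem) hεζ hδ p1 p2 p3
  rw [e]
  refine ⟨this.1, ?_⟩
  rw [show 2 * lam0 / M ^ 3 = lam0 * (2 / M ^ 3) by ring]
  exact this.2.trans (le_of_eq (by ring))

end ThinTube

end

/-! ### Norm convergence of the inverses -/

theorem mainTheorem4
    (a b : ℝ) (ha : 0 < a) (hb : 0 < b)
    (r N B : ℝ → ThinTube.Space) (k τ α h : ℝ → ℝ) (M : ℝ)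
    (hcurve : ThinTube.IsFrenetCurve (Icc (-a) b) r N B k τ)
    (hτ : ∃ C : ℝ, ∀ᵐ s ∂(volume.restrict (Icc (-a) b)), |τ s| ≤ C)
    (hα : DifferentiableOn ℝ α (Icc (-a) b)) (hα0 : α 0 = 0)
    (hα' : ∃ C : ℝ, ∀ᵐ s ∂(volume.restrict (Icc (-a) b)), |derivWithin α (Icc (-a) b) s| ≤ C)
    (hh : ThinTube.IsDeformation (Icc (-a) b) h M)
    (S : Set ThinTube.Plane) (hSo : IsOpen S) (hSb : Bornology.IsBounded S)
    (hSc : IsSimplyConnected S)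
    (lam0 : ℝ) (u0 : ThinTube.Plane → ℝ) (G0 : ThinTube.Plane → ThinTube.Plane)
    (hground : ThinTube.IsDirichletGroundState S lam0 u0 G0)
    (c : ℝ) :
    ∃ Tinv : ThinTube.L2 univ →L[ℂ] ThinTube.L2 univ,
      ThinTube.IsBoundedInverse
        (ThinTube.schrodinger univ fun s => 2 * lam0 / M ^ 3 * s ^ 2) Tinv ∧
      ∀ δ : ℝ, 0 < δ → ∃ ε₀ : ℝ, 0 < ε₀ ∧ ∀ (ε : ℝ) (hε : 0 < ε), ε < ε₀ →
        ∃ Rε : ThinTube.L2 (ThinTube.scaledInterval a b ε) →L[ℂ]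
            ThinTube.L2 (ThinTube.scaledInterval a b ε),
          ThinTube.IsBoundedInverse
            (ThinTube.conjScale (ThinTube.dilation a b hε) (ε : ℂ)
              (ThinTube.schrodinger (Ioo (-a) b)
                (ThinTube.effPotential (Icc (-a) b) S lam0 u0 G0 k τ α h M c ε))) Rε ∧
          ‖ThinTube.sumZero (ThinTube.measurableSet_scaledInterval a b ε) Rε - Tinv‖ < δ := by
  have hlam := hground.eigenvalue_pos hSb
  have hM := hh.M_pos
  set ν := 2 * lam0 / M ^ 3 with hν
  have hνpos : 0 < ν := by positivity
  have hzero : MemLp (fun s => (((fun _ => 0 : ℝ → ℝ) s : ℝ) : ℂ)) ⊤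
      (volume.restrict (univ : Set ℝ)) :=
    ThinTube.memLp_top_of_continuous_of_bound univ continuous_const (C := 0) (by simp)
  obtain ⟨Tinv, hTinv, hT⟩ := ThinTube.exists_schrodinger_inverse isOpen_univ hνpos
    (m := fun _ => 0) (V := fun s => ν * s ^ 2) hzero
    (.of_forall fun s => by linarith [ThinTube.coercivity_pos hνpos])
    (.of_forall fun s => (add_zero _).symm)
  refine ⟨Tinv, hTinv, fun δ hδ => ?_⟩
  obtain ⟨β, A₁, A₂, A₃, ε₁, hβ, hA₁, hA₂, hA₃, hε₁, hbd⟩ := ThinTube.exists_effPotential_bounds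
    ha hb hcurve hτ hα hα' hh S hlam u0 G0 c
  obtain ⟨D, hD⟩ := ThinTube.exists_cutoff
  have hκ := ThinTube.coercivity_pos hβ
  have hK := ThinTube.resolventBound_pos hνpos
  have hK' := ThinTube.resolventBound_pos hβ
  set K := ThinTube.resolventBound ν
  set K' := ThinTube.resolventBound β
  -- $L$ depends only on $\delta$ and on constants free of $\varepsilon$; tails and commutators
  -- together take $\delta/4$, and $\theta$ below allots another $\delta/4$ to the potentials.
  obtain ⟨L, hL, hLδ⟩ : ∃ L : ℝ, 0 < L ∧ (K + K' + 2 * D * K * K') / L ≤ δ / 4 := by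
    generalize K + K' + 2 * D * K * K' = X
    refine ⟨4 * (|X| + 1) / δ, by positivity, ?_⟩
    rw [div_le_iff₀ (by positivity)]
    have := le_abs_self X
    field_simp
    linarith
  obtain ⟨χ, χ', hχ, hχ', hsupp, hχb, hχ'b, hχL⟩ := hD L hL
  set θ := δ / (4 * (K * K')) with hθ
  have hθpos : 0 < θ := by positivity
  -- All requirements on $\varepsilon$ are of the form $f(\varepsilon)<x$ with $f$ continuous,
  -- $f(0)=0$, $x>0$. The third and fourth put $[-2L,2L]$ inside $I_\varepsilon$.
  have hev : ∀ᶠ ε in 𝓝 (0 : ℝ), ε < ε₁ ∧ ε * A₁ < ThinTube.coercivity β / 2 ∧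
      √ε * (2 * L) < a ∧ √ε * (2 * L) < b ∧
      ε * A₁ + √ε * (A₂ * (2 * L) ^ 3) + ε * (A₃ * (2 * L) ^ 2) < θ := by
    have key : ∀ (f : ℝ → ℝ) (x : ℝ), Continuous f → f 0 = 0 → 0 < x → ∀ᶠ ε in 𝓝 (0 : ℝ), f ε < x :=
      fun f x hf h0 hx => (hf.tendsto' 0 0 h0).eventually_lt_const hx
    refine (key _ _ continuous_id rfl hε₁).and ((key _ _ ?_ ?_ (by positivity)).and
      ((key _ _ ?_ ?_ ha).and ((key _ _ ?_ ?_ hb).and (key _ _ ?_ ?_ hθpos))))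
    all_goals first | fun_prop | simp
  obtain ⟨ε₀, hε₀, hball⟩ := Metric.eventually_nhds_iff.1 hev
  refine ⟨ε₀, hε₀, fun ε hε hεlt => ?_⟩
  obtain ⟨c1, c2, c3, c4, c5⟩ := hball (y := ε) (by
    rwa [dist_zero_right, Real.norm_of_nonneg hε.le])
  have hs := Real.sqrt_pos.2 hε
  have hbε := hbd ε hε c1
  set W := ThinTube.effPotential (Icc (-a) b) S lam0 u0 G0 k τ α h M c ε with hW
  have hWm : AEStronglyMeasurable (fun s => ε * W (√ε * s))
      (volume.restrict (ThinTube.scaledInterval a b ε)) :=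
    (ThinTube.aestronglyMeasurable_dilate hs (ThinTube.preimage_interval a b hε)
      (ThinTube.aestronglyMeasurable_effPotential (by linarith) hcurve hα.continuousOn
        hh.continuousOn S lam0 u0 G0 M c ε)).const_mul ε
  have hpow : ∀ (x : ℝ) (n : ℕ), AEStronglyMeasurable (fun s : ℝ => x * s ^ n)
      (volume.restrict (ThinTube.scaledInterval a b ε)) := fun x n =>
    (by fun_prop : Continuous fun s : ℝ => x * s ^ n).aestronglyMeasurable
  -- $m=V_\varepsilon-\beta s^2$ is bounded because $I_\varepsilon$ is. The bound grows as
  -- $\varepsilon\to0$, which is harmless: the resolvent estimate uses only $m\ge-\varepsilon A_1$.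
  have hm : MemLp (fun s => ((ε * W (√ε * s) - β * s ^ 2 : ℝ) : ℂ)) ⊤
      (volume.restrict (ThinTube.scaledInterval a b ε)) := by
    set Q := (a + b) / √ε with hQ
    refine memLp_top_of_bound
      (Complex.continuous_ofReal.comp_aestronglyMeasurable (hWm.sub (hpow β 2)))
      (ε * A₁ + √ε * (A₂ * Q ^ 3) + ε * (A₃ * Q ^ 2) + (ν + β) * Q ^ 2) ?_
    filter_upwards [hbε, ae_restrict_mem (ThinTube.measurableSet_scaledInterval a b ε)] with s h1 h2
    have hsQ : |s| ≤ Q := by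
      rw [abs_le, hQ, ← neg_div]
      exact ⟨(div_le_div_of_nonneg_right (by linarith) hs.le).trans h2.1.le,
        h2.2.le.trans (div_le_div_of_nonneg_right (by linarith) hs.le)⟩
    have hsQ2 : s ^ 2 ≤ Q ^ 2 := by rw [← sq_abs]; gcongr
    have e : ε * W (√ε * s) - β * s ^ 2 = (ε * W (√ε * s) - ν * s ^ 2) + (ν - β) * s ^ 2 := by ring
    have h3 : |(ν - β) * s ^ 2| ≤ (ν + β) * Q ^ 2 := by
      rw [abs_mul, abs_of_nonneg (sq_nonneg s)]
      gcongr
      exact (abs_sub _ _).trans (by rw [abs_of_pos hνpos, abs_of_pos hβ])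
    rw [Complex.norm_real, e]
    refine (norm_add_le _ _).trans (add_le_add (h1.2.trans ?_) h3)
    gcongr
  obtain ⟨R, hRinv, hR⟩ := ThinTube.exists_schrodinger_inverse
    (Ω := ThinTube.scaledInterval a b ε) isOpen_Ioo hβ (V := fun s => ε * W (√ε * s)) hm
    (by filter_upwards [hbε] with s h1; linarith [h1.1])
    (.of_forall fun s => by ring)
  refine ⟨R, ThinTube.isBoundedInverse_conjScale a b hε hRinv, ?_⟩
  refine (ThinTube.norm_sumZero_sub_le (ThinTube.measurableSet_scaledInterval a b ε) hK'.le hT hR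
    hχ hχ' (hsupp.trans ?_) hχb hθpos.le hχ'b hL hχL ((hpow ν 2).sub hWm) ?_ (half_pos hδ).le
    ?_).trans_lt (half_lt_self hδ)
  · intro s hsI
    refine ⟨?_, ?_⟩
    · rw [div_lt_iff₀ hs]
      nlinarith [hsI.1]
    · rw [lt_div_iff₀ hs]
      nlinarith [hsI.2]
  · filter_upwards [hbε] with s h1
    by_cases hsI : s ∈ Icc (-(2 * L)) (2 * L)
    · have hsL : |s| ≤ 2 * L := abs_le.2 hsI
      have hsL2 : s ^ 2 ≤ (2 * L) ^ 2 := by rw [← sq_abs]; gcongr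
      rw [abs_mul, abs_sub_comm]
      refine (mul_le_of_le_one_left (abs_nonneg _) (hχb s)).trans (h1.2.trans (le_trans ?_ c5.le))
      gcongr
    · rw [image_eq_zero_of_notMem_tsupport fun hmem => hsI (hsupp hmem), zero_mul, abs_zero]
      exact hθpos.le
  · have e1 : (K + K') / L + 2 * (D / L) * K * K' = (K + K' + 2 * D * K * K') / L := by ring
    have e2 : θ * K * K' = δ / 4 := by rw [hθ]; field_simp
    rw [e1, e2]
    linarith
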